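/- Let $m\ge 1$. Work with Pauli operators modulo phases: the operators on one site with $m$ qubits form the space $\mathcal P_m=\mathbb F_2^{2m}$ with the symplectic form $\lambda$ ($\lambda(a,b)=1$ iff $a,b$ anticommute). A Pauli operator on the lattice $\mathbb Z^3$ with $m$ qubits per site is a map $\mathbb Z^3\to\mathcal P_m$; a code is a group $S$ of pairwise commuting finitely supported Pauli operators (its stabilizer group modulo phases), and $S^\perp$ denotes the set of all Pauli operators, possibly of infinite support, that commute with every element of $S$ (the logical operators). For $E\in\mathcal P_m$ and $v,p\in\mathbb Z^3$, $E[v]_p$ is the operator acting by $E$ on the sites $p+nv$ $(n\in\mathbb Z)$ and trivially elsewhere. Consider codes $S$ such that: 1. $m\in\{1,2\}$. 2. $S$ is the group of all finite products of the translates of two generators $Q_1,Q_2$, each acting by corner operators $Q_t(c)\in\mathcal P_m$ on the eight corners $c\in\{0,1\}^3$ of the unit cube, where either - (inversion form, required of non-CSS codes) $Q_2(c)=Q_1((1,1,1)-c)$ for all $c$; or - (CSS form) all $Q_1(c)$ are of $Z$-type, all $Q_2(c)$ are of $X$-type, and $\prod_c Q_1(c)=\prod_c Q_2(c)=I$ up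 to phase. 3. If $E\in S^\perp$ is supported on a single site, then $E$ is the identity up to phase. 4. If $E[v]_p\in S^\perp$ with $\|v\|_\infty=1$, then $E[v]_p$ is the identity up to phase. Call two codes equivalent if one is mapped to the other by one of the $48$ symmetries of the unit cube (acting on $\mathbb Z^3$) together with a symplectic basis change of $\mathcal P_m$, the same on all sites. (The names of the generators are immaterial, since a code is its stabilizer group.) Name the corners $A=(1,0,1)$, $B=(1,1,1)$, $C=(1,0,0)$, $D=(1,1,0)$, and let $A',B',C',D'$ be the respective body-opposite corners. The following table lists $Q_1$ for $18$ codes with $m=2$. For code $0$, $Q_2$ is the spatial inversion of $Q_1$, $Q_2(c)=Q_1((1,1,1)-c)$. For codes $1,\dots,17$, $Q_2(c)$ is obtained from $Q_1((1,1,1)-c)$ by replacing $Z$ with $X$ and exchanging the two qubits. $$\begin{array}{c|cccccccc} &A&B&C&D&A'&B'&C'&D'\\ \hline 0&XX&ZI&ZY&XY&ZZ&II&XZ&ZX\\ 1&ZI&ZZ&IZ&ZI&IZ&II&ZI&IZ\\ 2&IZ&ZZ&ZI&ZI&ZI&ZZ&IZ&ZI\\ 3&IZ&ZZ&ZZ&ZI&ZZ&II&IZ&IZ\\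 4&IZ&ZZ&ZI&ZI&IZ&II&IZ&ZI\\ 5&ZI&ZZ&II&ZZ&ZI&II&IZ&IZ\\ 6&ZI&II&ZI&ZZ&IZ&ZZ&II&IZ\\ 7&ZI&ZZ&ZI&IZ&IZ&II&II&ZZ\\ 8&ZI&ZI&IZ&ZZ&IZ&II&IZ&ZI\\ 9&ZI&IZ&ZZ&ZZ&IZ&ZZ&II&IZ\\ 10&ZI&IZ&ZI&ZZ&IZ&ZZ&ZI&ZI\\ 11&ZI&ZZ&II&IZ&ZI&II&IZ&ZZ\\ 12&ZI&IZ&ZZ&ZZ&ZI&II&II&IZ\\ 13&ZI&ZZ&IZ&ZI&IZ&II&II&ZZ\\ 14&ZI&IZ&ZZ&ZZ&IZ&II&ZZ&IZ\\ 15&ZI&IZ&II&ZZ&IZ&ZZ&II&ZI\\ 16&ZI&ZI&II&IZ&IZ&ZZ&II&ZZ\\ 17&ZI&ZZ&IZ&ZI&IZ&ZI&ZI&ZZ \end{array}$$ Then: - No code with $m=1$ satisfies Conditions 1–4. - Code $0$ satisfies Conditions 1–4 in the inversion form, and every code with $m=2$ that does so is equivalent to code $0$. None of these codes is CSS with respect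 to any symplectic basis of $\mathcal P_2$ (used on all sites), i.e. in no such basis is every stabilizer element a product of an $X$-type and a $Z$-type stabilizer element. - Codes $1,\dots,17$ satisfy Conditions 1–4 in the CSS form, and every code with $m=2$ that does so is equivalent to one of them. - The $18$ codes are pairwise inequivalent. Hence, up to equivalence, exactly one non-CSS code and exactly $17$ CSS codes satisfy Conditions 1–4. -/

import Mathlib

namespace CubicCode

/-- Sites of the infinite simple cubic lattice `ℤ³`. The norm on this type is the `ℓ^∞` norm. -/
abbrev Site := Fin 3 → ℤ

/-- The Pauli group on `m` qubits modulo phases, as a vector space over `𝔽₂`: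
the first component records the `X` part, the second one the `Z` part. The product of
operators is the sum of vectors, and the identity (up to phase) is `0`. -/
abbrev OnSite (m : ℕ) := (Fin m → ZMod 2) × (Fin m → ZMod 2)

/-- The symplectic form: `1` if the two Pauli operators anticommute, `0` if they commute. -/
def symp {m : ℕ} (a b : OnSite m) : ZMod 2 :=
  ∑ i, (a.1 i * b.2 i + a.2 i * b.1 i)

/-- Pauli operators of finite support on the lattice with `m` qubits per site, modulo phases. -/
abbrev FinitePauli (m : ℕ) := Site →₀ OnSite m

/-- Commutation of a finite Pauli operator `s` with a Pauli operator `l` of possibly infinite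
support: `0` if they commute, `1` if they anticommute. -/
def comm {m : ℕ} (s : FinitePauli m) (l : Site → OnSite m) : ZMod 2 :=
  s.sum fun p a => symp a (l p)

/-- `l ∈ S^⊥`: the (possibly infinite) Pauli operator `l` commutes with every element of `S`. -/
def IsLogical {m : ℕ} (S : AddSubgroup (FinitePauli m)) (l : Site → OnSite m) : Prop :=
  ∀ s ∈ S, comm s l = 0

/-- The eight corners of the unit cube `{0,1}³`. -/
abbrev Corner := Fin 3 → Fin 2

/-- The body-opposite corner. -/
def antipode (c : Corner) : Corner := fun i => (c i).rev

/-- The position of a corner in the lattice. -/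
def cornerSite (c : Corner) : Site := fun i => ((c i : ℕ) : ℤ)

/-- The operator acting on the eight corners of the cube at `p` by the corner operators `q`. -/
noncomputable def place {m : ℕ} (q : Corner → OnSite m) (p : Site) : FinitePauli m :=
  ∑ c, Finsupp.single (p + cornerSite c) (q c)

/-- The group of all finite products of translates of the two generators `g 0` and `g 1`. -/
noncomputable def stabilizerGroup {m : ℕ} (g : Fin 2 → Corner → OnSite m) :
    AddSubgroup (FinitePauli m) :=
  AddSubgroup.closure (Set.range fun x : Fin 2 × Site => place (g x.1) x.2)

/-- The operator that acts by `E` on the site `p` and trivially elsewhere. -/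
def siteOp {m : ℕ} (E : OnSite m) (p : Site) : Site → OnSite m :=
  fun q => if q = p then E else 0

open Classical in
/-- The operator `E[v]_p`, in which `E` is repeated on the line `{p + n v : n ∈ ℤ}`. -/
noncomputable def lineOp {m : ℕ} (E : OnSite m) (v p : Site) : Site → OnSite m :=
  fun q => if ∃ n : ℤ, q = p + n • v then E else 0

/-- The requirements common to all cubic codes, on a subgroup `S` of the finite Pauli operators
modulo phases. -/
structure IsAdmissible {m : ℕ} (S : AddSubgroup (FinitePauli m)) : Prop where
  /-- There are one or two qubits per site. -/
  qubits : m = 1 ∨ m = 2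
  /-- The elements of `S` commute, so that `S` represents a stabilizer group. -/
  commutes : ∀ s ∈ S, IsLogical S s
  /-- A logical operator on a single site is the identity. -/
  single_site : ∀ (E : OnSite m) (p : Site), IsLogical S (siteOp E p) → siteOp E p = 0
  /-- A logical operator of period one is the identity. -/
  period_one : ∀ (E : OnSite m) (v p : Site), ‖v‖ = 1 →
    IsLogical S (lineOp E v p) → lineOp E v p = 0

/-- CSS cubic codes: one generator consists of `Z`-type and the other one of `X`-type corner
operators, and the product of all corner operators of each of them is the identity. -/
def IsCSSCubicCode {m : ℕ} (S : AddSubgroup (FinitePauli m)) : Prop :=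
  IsAdmissible S ∧ ∃ g : Fin 2 → Corner → OnSite m, S = stabilizerGroup g ∧
    (∀ c, (g 0 c).1 = 0) ∧ (∀ c, (g 1 c).2 = 0) ∧ ∀ t, ∑ c, g t c = 0

/-- Cubic codes whose two generators are the spatial inversions of each other (the form that is
required of non-CSS cubic codes; being non-CSS is not part of this definition). -/
def IsInversionCubicCode {m : ℕ} (S : AddSubgroup (FinitePauli m)) : Prop :=
  IsAdmissible S ∧ ∃ g : Fin 2 → Corner → OnSite m, S = stabilizerGroup g ∧
    ∀ c, g 1 c = g 0 (antipode c)

/-- A symplectic change of basis of the Pauli group of one site. -/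
def IsSymplectic {m : ℕ} (u : OnSite m ≃ₗ[ZMod 2] OnSite m) : Prop :=
  ∀ a b, symp (u a) (u b) = symp a b

/-- The code is CSS with respect to some symplectic basis, the same on all sites: every
stabilizer element is the product of an `X`-type and a `Z`-type stabilizer element. -/
def IsCSS {m : ℕ} (S : AddSubgroup (FinitePauli m)) : Prop :=
  ∃ u : OnSite m ≃ₗ[ZMod 2] OnSite m, IsSymplectic u ∧ ∀ s ∈ S, ∃ x ∈ S, ∃ z ∈ S,
    s = x + z ∧ (∀ p, (u (x p)).2 = 0) ∧ (∀ p, (u (z p)).1 = 0)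

/-- The 48 symmetries of the unit cube `[0,1]³`, acting on the lattice: a permutation `π` of the
coordinates followed by the reflections `x ↦ 1 - x` of the coordinates marked by `f`. -/
def cubeSym (π : Equiv.Perm (Fin 3)) (f : Fin 3 → Bool) (p : Site) : Site :=
  fun i => if f i then 1 - p (π i) else p (π i)

/-- The action of a cube symmetry and an on-site change of basis on finite Pauli operators. -/
noncomputable def transform {m : ℕ} (π : Equiv.Perm (Fin 3)) (f : Fin 3 → Bool)
    (u : OnSite m ≃ₗ[ZMod 2] OnSite m) : FinitePauli m →+ FinitePauli m :=
  (Finsupp.mapRange.addMonoidHom u.toLinearMap.toAddMonoidHom).comp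
    (Finsupp.mapDomain.addMonoidHom (cubeSym π f))

/-- Equivalence of codes under cube symmetries and on-site symplectic changes of basis. The
stabilizer group does not depend on the names of its generators. -/
def Equivalent {m : ℕ} (S S' : AddSubgroup (FinitePauli m)) : Prop :=
  ∃ (π : Equiv.Perm (Fin 3)) (f : Fin 3 → Bool) (u : OnSite m ≃ₗ[ZMod 2] OnSite m),
    IsSymplectic u ∧ S' = S.map (transform π f u)

/-- Single-qubit Pauli operators, with the `X` part first. -/
inductive Letter
  | I
  | X
  | Y
  | Z

/-- The `X` and the `Z` part of a single-qubit Pauli operator. -/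
def Letter.bits : Letter → ZMod 2 × ZMod 2
  | .I => (0, 0)
  | .X => (1, 0)
  | .Y => (1, 1)
  | .Z => (0, 1)

/-- A two-qubit Pauli operator. -/
def two (a b : Letter) : OnSite 2 :=
  (![a.bits.1, b.bits.1], ![a.bits.2, b.bits.2])

def II : OnSite 2 := two .I .I
def IZ : OnSite 2 := two .I .Z
def ZI : OnSite 2 := two .Z .I
def ZZ : OnSite 2 := two .Z .Z
def XX : OnSite 2 := two .X .X
def XY : OnSite 2 := two .X .Y
def XZ : OnSite 2 := two .X .Z
def ZX : OnSite 2 := two .Z .X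
def ZY : OnSite 2 := two .Z .Y

/-- Corner operators from their names: `A, B, C, D` sit at `(1,0,1), (1,1,1), (1,0,0), (1,1,0)`,
and `A', B', C', D'` at the respective body-opposite corners. -/
def corners (A B C D A' B' C' D' : OnSite 2) : Corner → OnSite 2 :=
  fun c => ![![![B', D'], ![A', C']], ![![C, A], ![D, B]]] (c 0) (c 1) (c 2)

/-- The list of first generators (the `Z`-type ones for the codes `1, …, 17`). -/
def firstGenerator : Fin 18 → Corner → OnSite 2 :=
  ![corners XX ZI ZY XY ZZ II XZ ZX,
    corners ZI ZZ IZ ZI IZ II ZI IZ,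
    corners IZ ZZ ZI ZI ZI ZZ IZ ZI,
    corners IZ ZZ ZZ ZI ZZ II IZ IZ,
    corners IZ ZZ ZI ZI IZ II IZ ZI,
    corners ZI ZZ II ZZ ZI II IZ IZ,
    corners ZI II ZI ZZ IZ ZZ II IZ,
    corners ZI ZZ ZI IZ IZ II II ZZ,
    corners ZI ZI IZ ZZ IZ II IZ ZI,
    corners ZI IZ ZZ ZZ IZ ZZ II IZ,
    corners ZI IZ ZI ZZ IZ ZZ ZI ZI,
    corners ZI ZZ II IZ ZI II IZ ZZ,
    corners ZI IZ ZZ ZZ ZI II II IZ,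
    corners ZI ZZ IZ ZI IZ II II ZZ,
    corners ZI IZ ZZ ZZ IZ II ZZ IZ,
    corners ZI IZ II ZZ IZ ZZ II ZI,
    corners ZI ZI II IZ IZ ZZ II ZZ,
    corners ZI ZZ IZ ZI IZ ZI ZI ZZ]

/-- The `X`-type operator obtained from a `Z`-type one by `Z ↦ X` and exchange of the qubits. -/
def dualX (a : OnSite 2) : OnSite 2 := (![a.2 1, a.2 0], 0)

/-- The two generators of the listed codes: the second generator of code `0` is the spatial
inversion of the first one; that of a CSS code is the spatial inversion followed by `dualX`. -/
def tableGenerators (k : Fin 18) : Fin 2 → Corner → OnSite 2 :=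
  ![firstGenerator k,
    fun c => if k = 0 then firstGenerator k (antipode c)
      else dualX (firstGenerator k (antipode c))]

/-- The stabilizer groups of the listed codes. -/
noncomputable def tableCode (k : Fin 18) : AddSubgroup (FinitePauli 2) :=
  stabilizerGroup (tableGenerators k)

end CubicCode

/-!
A cube operator is studied through the functions `c ↦ symp (q c) E` on the eight corners, which
record where `E` anticommutes with it. The operator `E[v]_p` commutes with all translates of the
cube operator if and only if this function has an even sum on every line of direction `v` through
the cube. So the conditions on single-site and period-one logical operators say that these
functions, for `E ≠ 0`, are string-free: in every direction of norm one some line has an odd sum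
(`StringFree`). A function on the corners is a byte (`pack`), and 202 of the 256 bytes are
string-free, 74 of them with an even number of ones.

By Witt's theorem (`exists_symplectic`) the generators are determined, up to an on-site symplectic
change of basis, by their commutation matrix, because they span the Pauli group of the site
(`equivalent_of_gram`). Hence it suffices to classify commutation matrices up to the symmetries of
the cube.

*Inversion form.* The commutation matrix of the first generator is alternating, and the commutation
of its translates says that the sums of the entries along parallel edges, face diagonals and body
diagonals vanish. This leaves 15 free bits (`altRows`). Every sum of rows must be zero or
string-free, and only the zero matrix and the 16 images of the matrix of code `0` satisfy this
(`altRowsCheck`). This does not refer to the number of qubits. On one qubit there are too few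
operators for the eight distinct rows of that matrix.

*CSS form.* The first generator consists of two bytes `a`, `b` such that `a`, `b` and `a + b` are
string-free and even. All such pairs belong to the listed codes, up to symmetries of the cube and
changes of basis (`pairsInTableOrbits`). For a listed first generator, commutation of cubes that
overlap in a corner or in an edge determines the second generator (`dualUnique`). On one qubit, the
same overlaps exclude every pair of bytes (`noOverlapPair`).

*Inequivalence.* At the corners `A` and `A'` the two generators of each listed code are independent,
so a stabilizer element supported on a cube is a product of the generators at that cube: in any
other product an extremal cube has an uncancelled corner outside of that cube
(`exists_eq_sum_of_supportedOnCube`). An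
equivalence therefore maps the first generator of one code to a product of the generators of the
other at one cube. The set of bytes `c ↦ symp (q c) E`, where `E` varies, does not depend on the
symplectic basis, and a comparison of these sets shows that this is impossible
(`tableCodesDiffer`). In the same way, the `X` and `Z` parts of the first generator of code `0`
with respect to a CSS basis would be products of the two generators at one cube, but no such
nontrivial product has commuting corner operators (`not_isCSS_tableCode_zero`).

The finite checks are Boolean functions of natural numbers, whose binary digits encode functions on
the corners or sets of bytes; the kernel evaluates them.
-/

namespace CubicCode

/-! ### The symplectic form -/

theorem symp_add_left {m : ℕ} (a b c : OnSite m) : symp (a + b) c = symp a c + symp b c := by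
  simp only [symp, ← Finset.sum_add_distrib, Prod.fst_add, Prod.snd_add, Pi.add_apply]
  exact Finset.sum_congr rfl fun i _ => by ring

theorem symp_comm {m : ℕ} (a b : OnSite m) : symp a b = symp b a := by
  simp only [symp]
  exact Finset.sum_congr rfl fun i _ => by ring

theorem symp_add_right {m : ℕ} (a b c : OnSite m) : symp a (b + c) = symp a b + symp a c := by
  rw [symp_comm, symp_add_left, symp_comm b, symp_comm c]

theorem symp_smul_left {m : ℕ} (x : ZMod 2) (a b : OnSite m) : symp (x • a) b = x * symp a b := by
  simp only [symp, Finset.mul_sum, Prod.smul_fst, Prod.smul_snd, Pi.smul_apply, smul_eq_mul]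
  exact Finset.sum_congr rfl fun i _ => by ring

theorem symp_smul_right {m : ℕ} (x : ZMod 2) (a b : OnSite m) :
    symp a (x • b) = x * symp a b := by
  rw [symp_comm, symp_smul_left, symp_comm]

/-- The symplectic form as a bundled bilinear form. -/
def sympForm (m : ℕ) : LinearMap.BilinForm (ZMod 2) (OnSite m) :=
  LinearMap.mk₂ (ZMod 2) symp symp_add_left symp_smul_left symp_add_right symp_smul_right

@[simp]
theorem sympForm_apply {m : ℕ} (a b : OnSite m) : sympForm m a b = symp a b := rfl

@[simp]
theorem symp_zero_left {m : ℕ} (a : OnSite m) : symp 0 a = 0 := by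
  rw [← sympForm_apply, map_zero, LinearMap.zero_apply]

@[simp]
theorem symp_zero_right {m : ℕ} (a : OnSite m) : symp a 0 = 0 := by
  rw [symp_comm, symp_zero_left]

theorem symp_self {m : ℕ} (a : OnSite m) : symp a a = 0 := by
  simp only [symp]
  exact Finset.sum_eq_zero fun i _ => by rw [mul_comm, CharTwo.add_self_eq_zero]

theorem symp_sum_left {m : ℕ} {ι : Type*} (s : Finset ι) (a : ι → OnSite m) (b : OnSite m) :
    symp (∑ i ∈ s, a i) b = ∑ i ∈ s, symp (a i) b := by
  simp only [← sympForm_apply, map_sum, LinearMap.sum_apply]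

theorem symp_sum_right {m : ℕ} {ι : Type*} (s : Finset ι) (a : OnSite m) (b : ι → OnSite m) :
    symp a (∑ i ∈ s, b i) = ∑ i ∈ s, symp a (b i) := by
  simp only [← sympForm_apply, map_sum]

/-- Every linear functional on the Pauli group of a site is the commutation with an operator. -/
theorem exists_symp_eq {m : ℕ} (f : OnSite m →ₗ[ZMod 2] ZMod 2) : ∃ E, ∀ a, f a = symp a E := by
  refine ⟨(fun i => f (0, Pi.single i 1), fun i => f (Pi.single i 1, 0)), fun a => ?_⟩
  have h : a = ∑ i, (a.1 i • ((Pi.single i 1, 0) : OnSite m) +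
      a.2 i • ((0, Pi.single i 1) : OnSite m)) := by
    ext j <;> simp [Prod.fst_sum, Prod.snd_sum, Finset.sum_apply, Pi.single_apply]
  conv_lhs => rw [h]
  simp only [map_sum, map_add, map_smul, symp, smul_eq_mul]

theorem symp_nondegenerate {m : ℕ} {a : OnSite m} (h : ∀ b, symp a b = 0) : a = 0 := by
  ext i
  · simpa [symp, Pi.single_apply] using h (0, Pi.single i 1)
  · simpa [symp, Pi.single_apply] using h (Pi.single i 1, 0)

/-- A family of on-site operators is separating if only the identity commutes with all of them,
that is, if it spans the Pauli group of the site. -/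
def IsSeparating {m : ℕ} {ι : Type*} (g : ι → OnSite m) : Prop :=
  ∀ E, (∀ i, symp (g i) E = 0) → E = 0

theorem IsSeparating.linearCombination_surjective {m : ℕ} {ι : Type*} {g : ι → OnSite m}
    (hg : IsSeparating g) : Function.Surjective (Finsupp.linearCombination (ZMod 2) g) := by
  rw [← LinearMap.range_eq_top]
  by_contra h
  obtain ⟨f, hf, hle⟩ := Submodule.exists_le_ker_of_lt_top _ (lt_top_iff_ne_top.2 h)
  obtain ⟨E, hE⟩ := exists_symp_eq f
  have : E = 0 := hg E fun i => by
    rw [← hE, ← LinearMap.mem_ker]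
    exact hle ⟨Finsupp.single i 1, by simp⟩
  exact hf (LinearMap.ext fun a => by rw [hE, this, symp_zero_right, LinearMap.zero_apply])

/-- Witt's theorem in the form used here: two separating families with the same commutation
relations differ by a symplectic change of basis. The linear relations of a separating family
can be read off from the commutation relations, because the form is nondegenerate. -/
theorem exists_symplectic {m : ℕ} {ι : Type*} {g h : ι → OnSite m} (hg : IsSeparating g)
    (hh : IsSeparating h) (gram : ∀ i j, symp (g i) (g j) = symp (h i) (h j)) :
    ∃ u : OnSite m ≃ₗ[ZMod 2] OnSite m, IsSymplectic u ∧ ∀ i, u (g i) = h i := by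
  set G := Finsupp.linearCombination (ZMod 2) g with hG
  set H := Finsupp.linearCombination (ZMod 2) h with hH
  have hGs : Function.Surjective G := hg.linearCombination_surjective
  have hHs : Function.Surjective H := hh.linearCombination_surjective
  have expand : ∀ x y, symp (G x) (G y) = symp (H x) (H y) := fun x y => by
    simp only [hG, hH, Finsupp.linearCombination_apply, Finsupp.sum, symp_sum_left,
      symp_sum_right, symp_smul_left, symp_smul_right, gram]
  have hker : LinearMap.ker G = LinearMap.ker H := by
    ext x
    simp only [LinearMap.mem_ker]
    constructor
    · intro hx
      refine symp_nondegenerate fun b => ?_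
      obtain ⟨y, rfl⟩ := hHs b
      rw [← expand, hx, symp_zero_left]
    · intro hx
      refine symp_nondegenerate fun b => ?_
      obtain ⟨y, rfl⟩ := hGs b
      rw [expand, hx, symp_zero_left]
  let u : OnSite m ≃ₗ[ZMod 2] OnSite m :=
    (G.quotKerEquivOfSurjective hGs).symm.trans
      ((Submodule.quotEquivOfEq _ _ hker).trans (H.quotKerEquivOfSurjective hHs))
  have hu : ∀ x, u (G x) = H x := fun x => by
    simp only [u, LinearEquiv.trans_apply, LinearMap.quotKerEquivOfSurjective_symm_apply,
      Submodule.quotEquivOfEq_mk, LinearMap.quotKerEquivOfSurjective_apply_mk]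
  refine ⟨u, fun a b => ?_, fun i => ?_⟩
  · obtain ⟨x, rfl⟩ := hGs a
    obtain ⟨y, rfl⟩ := hGs b
    rw [hu, hu, expand]
  · simpa [hG, hH] using hu (Finsupp.single i 1)

/-! ### Logical operators in terms of the generators -/

theorem place_apply {m : ℕ} (q : Corner → OnSite m) (p x : Site) :
    place q p x = ∑ c, if p + cornerSite c = x then q c else 0 := by
  simp [place, Finsupp.finsetSum_apply, Finsupp.single_apply]

theorem comm_add_left {m : ℕ} (s t : FinitePauli m) (l : Site → OnSite m) :
    comm (s + t) l = comm s l + comm t l :=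
  Finsupp.sum_add_index' (fun _ => symp_zero_left _) fun _ _ _ => symp_add_left _ _ _

theorem comm_add_right {m : ℕ} (s : FinitePauli m) (l l' : Site → OnSite m) :
    comm s (l + l') = comm s l + comm s l' := by
  simp only [comm, Finsupp.sum, Pi.add_apply, symp_add_right, Finset.sum_add_distrib]

theorem comm_zero_left {m : ℕ} (l : Site → OnSite m) : comm 0 l = 0 :=
  Finsupp.sum_zero_index

theorem comm_zero_right {m : ℕ} (s : FinitePauli m) : comm s 0 = 0 := by
  simp [comm]

theorem comm_place {m : ℕ} (q : Corner → OnSite m) (p : Site) (l : Site → OnSite m) :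
    comm (place q p) l = ∑ c, symp (q c) (l (p + cornerSite c)) := by
  let f : FinitePauli m →+ ZMod 2 := ⟨⟨fun s => comm s l, comm_zero_left l⟩,
    fun s t => comm_add_left s t l⟩
  have hf : ∀ x a, f (Finsupp.single x a) = symp a (l x) := fun x a =>
    Finsupp.sum_single_index (h := fun p a => symp a (l p)) (symp_zero_left _)
  change f (∑ c, _) = _
  rw [map_sum]
  exact Finset.sum_congr rfl fun c _ => hf _ _

/-- In characteristic two, closure under negation is automatic. -/
theorem neg_eq_self {m : ℕ} (s : FinitePauli m) : -s = s := by
  ext p i <;> simp [ZMod.neg_eq_self_mod_two]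

theorem place_mem {m : ℕ} (g : Fin 2 → Corner → OnSite m) (t : Fin 2) (p : Site) :
    place (g t) p ∈ stabilizerGroup g :=
  AddSubgroup.subset_closure ⟨(t, p), rfl⟩

/-- An additive property of the stabilizer elements holds if it does so for the generators. -/
theorem stabilizerGroup_induction {m : ℕ} {g : Fin 2 → Corner → OnSite m}
    {P : FinitePauli m → Prop} (hplace : ∀ t p, P (place (g t) p)) (hzero : P 0)
    (hadd : ∀ s t, P s → P t → P (s + t)) {s : FinitePauli m} (hs : s ∈ stabilizerGroup g) :
    P s := by
  induction hs using AddSubgroup.closure_induction with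
  | mem x hx => obtain ⟨⟨t, p⟩, rfl⟩ := hx; exact hplace t p
  | zero => exact hzero
  | add x y _ _ hx hy => exact hadd x y hx hy
  | neg x _ hx => rwa [neg_eq_self]

theorem isLogical_stabilizerGroup {m : ℕ} {g : Fin 2 → Corner → OnSite m}
    {l : Site → OnSite m} :
    IsLogical (stabilizerGroup g) l ↔
      ∀ t p, ∑ c, symp (g t c) (l (p + cornerSite c)) = 0 := by
  constructor
  · intro h t p
    rw [← comm_place]
    exact h _ (place_mem g t p)
  · intro h s hs
    refine stabilizerGroup_induction (P := fun s => comm s l = 0)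
      (fun t p => by rw [comm_place, h]) (comm_zero_left l) (fun s t hs ht => ?_) hs
    rw [comm_add_left, hs, ht, add_zero]

/-- All translates of the cube operators `q` and `q'` commute. -/
def Commuting {m : ℕ} (q q' : Corner → OnSite m) : Prop :=
  ∀ d : Site, ∑ c, ∑ c', (if cornerSite c = d + cornerSite c' then symp (q c) (q' c') else 0) = 0

theorem sum_symp_place {m : ℕ} (q q' : Corner → OnSite m) (p p' : Site) :
    ∑ c, symp (q c) (place q' p' (p + cornerSite c)) =
      ∑ c, ∑ c', if cornerSite c = (p' - p) + cornerSite c' then symp (q c) (q' c') else 0 := by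
  refine Finset.sum_congr rfl fun c _ => ?_
  rw [place_apply, symp_sum_right]
  refine Finset.sum_congr rfl fun c' _ => ?_
  have : p' + cornerSite c' = p + cornerSite c ↔ cornerSite c = p' - p + cornerSite c' := by
    constructor
    · intro h; rw [sub_add_eq_add_sub, h, add_sub_cancel_left]
    · intro h; rw [h]; abel
  simp only [this, apply_ite (symp (q c)), symp_zero_right]

theorem stabilizerGroup_commutes_iff {m : ℕ} {g : Fin 2 → Corner → OnSite m} :
    (∀ s ∈ stabilizerGroup g, IsLogical (stabilizerGroup g) s) ↔
      ∀ t t', Commuting (g t) (g t') := by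
  constructor
  · intro h t t' d
    have := isLogical_stabilizerGroup.1 (h _ (place_mem g t' d)) t 0
    rwa [sum_symp_place, sub_zero] at this
  · intro h s hs
    refine stabilizerGroup_induction (P := fun s => IsLogical (stabilizerGroup g) s)
      (fun t p => ?_) (fun s _ => comm_zero_right s) (fun s t hs ht r hr => ?_) hs
    · rw [isLogical_stabilizerGroup]
      intro t' p'
      rw [sum_symp_place]
      exact h t' t _
    · rw [Finsupp.coe_add, comm_add_right, hs r hr, ht r hr, add_zero]

theorem siteOp_eq_zero_iff {m : ℕ} {E : OnSite m} {p : Site} : siteOp E p = 0 ↔ E = 0 := by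
  constructor
  · intro h
    simpa [siteOp] using congrFun h p
  · rintro rfl
    funext q
    simp [siteOp]

theorem lineOp_eq_zero_iff {m : ℕ} {E : OnSite m} {v p : Site} : lineOp E v p = 0 ↔ E = 0 := by
  constructor
  · intro h
    have := congrFun h p
    rwa [lineOp, if_pos ⟨0, by simp⟩] at this
  · rintro rfl
    funext q
    simp [lineOp]

theorem cornerSite_injective : Function.Injective cornerSite := fun c c' h => by
  funext i
  have := congrFun h i
  simp only [cornerSite] at this
  exact Fin.ext (by exact_mod_cast this)

theorem isLogical_siteOp {m : ℕ} {g : Fin 2 → Corner → OnSite m} {E : OnSite m} {p : Site} :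
    IsLogical (stabilizerGroup g) (siteOp E p) ↔ ∀ t c, symp (g t c) E = 0 := by
  rw [isLogical_stabilizerGroup]
  constructor
  · intro h t c
    have := h t (p - cornerSite c)
    rw [Finset.sum_eq_single c] at this
    · simpa [siteOp] using this
    · intro b _ hb
      have : p - cornerSite c + cornerSite b ≠ p := fun h => hb <| cornerSite_injective <| by
        rw [sub_add_eq_add_sub, sub_eq_iff_eq_add] at h
        exact add_left_cancel h
      simp [siteOp, this]
    · simp
  · intro h t q
    refine Finset.sum_eq_zero fun c _ => ?_
    unfold siteOp
    split_ifs
    · exact h t c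
    · exact symp_zero_right _

open Classical in
/-- The sum of `w` over the corners on the line through the corner `c₀` with direction `v`. -/
noncomputable def lineSum (v : Site) (w : Corner → ZMod 2) (c₀ : Corner) : ZMod 2 :=
  ∑ c, if ∃ n : ℤ, cornerSite c = cornerSite c₀ + n • v then w c else 0

theorem isLogical_lineOp {m : ℕ} {g : Fin 2 → Corner → OnSite m} {E : OnSite m} {v p : Site} :
    IsLogical (stabilizerGroup g) (lineOp E v p) ↔
      ∀ t c₀, lineSum v (fun c => symp (g t c) E) c₀ = 0 := by
  rw [isLogical_stabilizerGroup]
  have key : ∀ (t : Fin 2) (q : Site) (c₀ : Corner), (∃ n : ℤ, q + cornerSite c₀ = p + n • v) →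
      ∑ c, symp (g t c) (lineOp E v p (q + cornerSite c)) =
        lineSum v (fun c => symp (g t c) E) c₀ := by
    rintro t q c₀ ⟨n, hn⟩
    refine Finset.sum_congr rfl fun c _ => ?_
    have : (∃ k : ℤ, q + cornerSite c = p + k • v) ↔
        ∃ k : ℤ, cornerSite c = cornerSite c₀ + k • v := by
      have hp : p = q + cornerSite c₀ - n • v := by rw [hn]; abel
      constructor
      · rintro ⟨k, hk⟩
        refine ⟨k - n, ?_⟩
        rw [hp] at hk
        rw [sub_smul, ← add_left_cancel_iff (a := q), hk]
        abel
      · rintro ⟨k, hk⟩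
        refine ⟨k + n, ?_⟩
        rw [hk, hp, add_smul]
        abel
    simp only [lineOp, apply_ite (symp (g t c)), symp_zero_right]
    by_cases hk : ∃ k : ℤ, q + cornerSite c = p + k • v
    · rw [if_pos hk, if_pos (this.1 hk)]
    · rw [if_neg hk, if_neg (mt this.2 hk)]
  constructor
  · intro h t c₀
    rw [← key t (p - cornerSite c₀) c₀ ⟨0, by simp⟩]
    exact h t _
  · intro h t q
    by_cases hc : ∃ c₀, ∃ n : ℤ, q + cornerSite c₀ = p + n • v
    · obtain ⟨c₀, hc₀⟩ := hc
      rw [key t q c₀ hc₀, h]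
    · refine Finset.sum_eq_zero fun c _ => ?_
      have : lineOp E v p (q + cornerSite c) = 0 := by
        simp only [lineOp]
        rw [if_neg fun hn => hc ⟨c, hn⟩]
      rw [this, symp_zero_right]

/-- In every direction of norm one, some line through the cube carries an odd number of ones
of `w`. If `w` records which corner operators anticommute with `E`, then this says that no
operator `E[v]_p` with `‖v‖ = 1` commutes with all translates of the cube operator. -/
def StringFree (w : Corner → ZMod 2) : Prop :=
  ∀ v : Site, ‖v‖ = 1 → ∃ c₀, lineSum v w c₀ ≠ 0

theorem StringFree.ne_zero {w : Corner → ZMod 2} (h : StringFree w) : w ≠ 0 := by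
  rintro rfl
  obtain ⟨c₀, hc⟩ := h (fun _ => 1) (by simp)
  exact hc (by simp [lineSum])

/-- Sufficient conditions for admissibility in terms of the corner operators. -/
theorem isAdmissible_of_generators {m : ℕ} {g : Fin 2 → Corner → OnSite m} (hm : m = 1 ∨ m = 2)
    (hcomm : ∀ t t', Commuting (g t) (g t'))
    (hfree : ∀ E, E ≠ 0 → ∃ t, StringFree fun c => symp (g t c) E) :
    IsAdmissible (stabilizerGroup g) where
  qubits := hm
  commutes := stabilizerGroup_commutes_iff.2 hcomm
  single_site E p h := by
    rw [isLogical_siteOp] at h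
    rw [siteOp_eq_zero_iff]
    by_contra hE
    obtain ⟨t, ht⟩ := hfree E hE
    exact ht.ne_zero (funext fun c => h t c)
  period_one E v p hv h := by
    rw [isLogical_lineOp] at h
    rw [lineOp_eq_zero_iff]
    by_contra hE
    obtain ⟨t, ht⟩ := hfree E hE
    obtain ⟨c₀, hc⟩ := ht v hv
    exact hc (h t c₀)

theorem IsAdmissible.isSeparating {m : ℕ} {g : Fin 2 → Corner → OnSite m}
    (h : IsAdmissible (stabilizerGroup g)) :
    IsSeparating fun x : Fin 2 × Corner => g x.1 x.2 := fun E hE =>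
  siteOp_eq_zero_iff.1 <| h.single_site E 0 <| isLogical_siteOp.2 fun t c => hE (t, c)

theorem IsAdmissible.exists_lineSum_ne_zero {m : ℕ} {g : Fin 2 → Corner → OnSite m}
    (h : IsAdmissible (stabilizerGroup g)) {E : OnSite m} (hE : E ≠ 0) {v : Site}
    (hv : ‖v‖ = 1) : ∃ t c₀, lineSum v (fun c => symp (g t c) E) c₀ ≠ 0 := by
  by_contra hc
  push Not at hc
  exact hE (lineOp_eq_zero_iff.1 (h.period_one E v 0 hv (isLogical_lineOp.2 hc)))

/-! ### Symmetries of the cube -/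

theorem rev_fin_two (a : Fin 2) : (((a.rev : Fin 2) : ℕ) : ℤ) = 1 - ((a : ℕ) : ℤ) := by
  fin_cases a <;> rfl

/-- The permutation of the corners that is induced by a symmetry of the cube. -/
def cornerSym (π : Equiv.Perm (Fin 3)) (f : Fin 3 → Bool) : Corner ≃ Corner where
  toFun c i := if f i then (c (π i)).rev else c (π i)
  invFun c i := if f (π.symm i) then (c (π.symm i)).rev else c (π.symm i)
  left_inv c := by
    funext i
    by_cases h : f (π.symm i) <;> simp [h]
  right_inv c := by
    funext i
    by_cases h : f i <;> simp [h]

theorem cornerSite_cornerSym (π : Equiv.Perm (Fin 3)) (f : Fin 3 → Bool) (c : Corner) :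
    cornerSite (cornerSym π f c) = cubeSym π f (cornerSite c) := by
  funext i
  cases h : f i
  · simp [cornerSite, cornerSym, cubeSym, h]
  · simpa [cornerSite, cornerSym, cubeSym, h] using rev_fin_two (c (π i))

theorem antipode_antipode (c : Corner) : antipode (antipode c) = c := by
  funext i
  simp [antipode]

theorem cornerSym_antipode (π : Equiv.Perm (Fin 3)) (f : Fin 3 → Bool) (c : Corner) :
    cornerSym π f (antipode c) = antipode (cornerSym π f c) := by
  funext i
  by_cases h : f i <;> simp [cornerSym, antipode, h]

theorem cubeSym_injective (π : Equiv.Perm (Fin 3)) (f : Fin 3 → Bool) :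
    Function.Injective (cubeSym π f) := fun p q h => by
  funext i
  have := congrFun h (π.symm i)
  by_cases hf : f (π.symm i) <;> simpa [cubeSym, hf] using this

/-- The linear part of a symmetry of the cube. -/
def cubeSymLinear (π : Equiv.Perm (Fin 3)) (f : Fin 3 → Bool) (p : Site) : Site :=
  fun i => if f i then - p (π i) else p (π i)

theorem cubeSym_add (π : Equiv.Perm (Fin 3)) (f : Fin 3 → Bool) (p q : Site) :
    cubeSym π f (p + q) = cubeSymLinear π f p + cubeSym π f q := by
  funext i
  by_cases h : f i <;> simp [cubeSym, cubeSymLinear, h]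
  ring

theorem cubeSymLinear_surjective (π : Equiv.Perm (Fin 3)) (f : Fin 3 → Bool) :
    Function.Surjective (cubeSymLinear π f) := fun p =>
  ⟨fun i => if f (π.symm i) then - p (π.symm i) else p (π.symm i), by
    funext i
    by_cases h : f i <;> simp [cubeSymLinear, h]⟩

theorem cubeSymLinear_smul (π : Equiv.Perm (Fin 3)) (f : Fin 3 → Bool) (n : ℤ) (v : Site) :
    cubeSymLinear π f (n • v) = n • cubeSymLinear π f v := by
  funext i
  by_cases h : f i <;> simp [cubeSymLinear, h]

theorem norm_cubeSymLinear (π : Equiv.Perm (Fin 3)) (f : Fin 3 → Bool) (v : Site) :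
    ‖cubeSymLinear π f v‖ = ‖v‖ := by
  have h : ∀ i, ‖cubeSymLinear π f v i‖ = ‖v (π i)‖ := fun i => by
    by_cases h : f i <;> simp [cubeSymLinear, h]
  refine le_antisymm ((pi_norm_le_iff_of_nonneg (norm_nonneg _)).2 fun i => ?_)
    ((pi_norm_le_iff_of_nonneg (norm_nonneg _)).2 fun i => ?_)
  · rw [h]
    exact norm_le_pi_norm v _
  · rw [← π.apply_symm_apply i, ← h]
    exact norm_le_pi_norm (cubeSymLinear π f v) _

theorem lineSum_comp_equiv (σ : Corner ≃ Corner) {v v' : Site} {c₀ c₀' : Corner}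
    (h : ∀ c, (∃ n : ℤ, cornerSite c = cornerSite c₀ + n • v) ↔
      ∃ n : ℤ, cornerSite (σ c) = cornerSite c₀' + n • v') (w : Corner → ZMod 2) :
    lineSum v (fun c => w (σ c)) c₀ = lineSum v' w c₀' := by
  classical
  refine Fintype.sum_equiv σ _ _ fun c => ?_
  by_cases hc : ∃ n : ℤ, cornerSite c = cornerSite c₀ + n • v
  · exact (if_pos hc).trans (if_pos ((h c).1 hc)).symm
  · exact (if_neg hc).trans (if_neg (mt (h c).2 hc)).symm

theorem lineSum_comp_cornerSym (π : Equiv.Perm (Fin 3)) (f : Fin 3 → Bool) (v : Site)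
    (w : Corner → ZMod 2) (c₀ : Corner) :
    lineSum v (fun c => w (cornerSym π f c)) c₀ =
      lineSum (cubeSymLinear π f v) w (cornerSym π f c₀) :=
  lineSum_comp_equiv _ (fun c => exists_congr fun n => by
    rw [cornerSite_cornerSym, cornerSite_cornerSym, ← cubeSymLinear_smul, add_comm _ (n • v),
      add_comm _ (cubeSymLinear π f (n • v)), ← cubeSym_add, (cubeSym_injective π f).eq_iff]) w

theorem lineSum_neg (v : Site) (w : Corner → ZMod 2) (c₀ : Corner) :
    lineSum (-v) w c₀ = lineSum v w c₀ :=
  lineSum_comp_equiv (Equiv.refl _) (fun _ =>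
    ⟨fun ⟨n, h⟩ => ⟨-n, by rw [Equiv.refl_apply, h, neg_smul, smul_neg]⟩,
      fun ⟨n, h⟩ => ⟨-n, by rw [Equiv.refl_apply] at h; rw [h, smul_neg, neg_smul, neg_neg]⟩⟩) w

theorem stringFree_comp_cornerSym {π : Equiv.Perm (Fin 3)} {f : Fin 3 → Bool}
    {w : Corner → ZMod 2} :
    (StringFree fun c => w (cornerSym π f c)) ↔ StringFree w := by
  constructor
  · intro h v hv
    obtain ⟨v, rfl⟩ := cubeSymLinear_surjective π f v
    rw [norm_cubeSymLinear] at hv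
    obtain ⟨c₀, hc⟩ := h v hv
    exact ⟨_, lineSum_comp_cornerSym π f v w c₀ ▸ hc⟩
  · intro h v hv
    obtain ⟨c₀, hc⟩ := h (cubeSymLinear π f v) ((norm_cubeSymLinear π f v).trans hv)
    obtain ⟨c₀, rfl⟩ := (cornerSym π f).surjective c₀
    exact ⟨c₀, (lineSum_comp_cornerSym π f v w c₀).symm ▸ hc⟩

theorem transform_single {m : ℕ} (π : Equiv.Perm (Fin 3)) (f : Fin 3 → Bool)
    (u : OnSite m ≃ₗ[ZMod 2] OnSite m) (p : Site) (a : OnSite m) :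
    transform π f u (Finsupp.single p a) = Finsupp.single (cubeSym π f p) (u a) := by
  simp [transform, Finsupp.mapDomain_single]

theorem transform_apply {m : ℕ} (π : Equiv.Perm (Fin 3)) (f : Fin 3 → Bool)
    (u : OnSite m ≃ₗ[ZMod 2] OnSite m) (s : FinitePauli m) (p : Site) :
    transform π f u s (cubeSym π f p) = u (s p) := by
  simp [transform, Finsupp.mapDomain_apply (cubeSym_injective π f)]

theorem transform_apply_of_notMem_range {m : ℕ} (π : Equiv.Perm (Fin 3)) (f : Fin 3 → Bool)
    (u : OnSite m ≃ₗ[ZMod 2] OnSite m) (s : FinitePauli m) {p : Site}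
    (hp : p ∉ Set.range (cubeSym π f)) : transform π f u s p = 0 := by
  simp [transform, Finsupp.mapDomain_of_notMem_range _ _ hp]

theorem transform_place {m : ℕ} (π : Equiv.Perm (Fin 3)) (f : Fin 3 → Bool)
    (u : OnSite m ≃ₗ[ZMod 2] OnSite m) (q : Corner → OnSite m) (p : Site) :
    transform π f u (place q p) =
      place (fun c => u (q ((cornerSym π f).symm c))) (cubeSymLinear π f p) := by
  simp only [place, map_sum, transform_single, cubeSym_add, ← cornerSite_cornerSym]
  exact Fintype.sum_equiv (cornerSym π f) _ _ fun c => by simp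

theorem map_stabilizerGroup {m : ℕ} (π : Equiv.Perm (Fin 3)) (f : Fin 3 → Bool)
    (u : OnSite m ≃ₗ[ZMod 2] OnSite m) (g : Fin 2 → Corner → OnSite m) :
    (stabilizerGroup g).map (transform π f u) =
      stabilizerGroup fun t c => u (g t ((cornerSym π f).symm c)) := by
  rw [stabilizerGroup, AddMonoidHom.map_closure, stabilizerGroup]
  congr 1
  ext s
  constructor
  · rintro ⟨_, ⟨⟨t, p⟩, rfl⟩, rfl⟩
    exact ⟨(t, cubeSymLinear π f p), (transform_place π f u (g t) p).symm⟩
  · rintro ⟨⟨t, p⟩, rfl⟩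
    obtain ⟨p, rfl⟩ := cubeSymLinear_surjective π f p
    exact ⟨_, ⟨(t, p), rfl⟩, transform_place π f u (g t) p⟩

/-- Two separating pairs of generators with the same commutation relations up to a symmetry of
the cube define equivalent codes. -/
theorem equivalent_of_gram {m : ℕ} {g h : Fin 2 → Corner → OnSite m}
    (π : Equiv.Perm (Fin 3)) (f : Fin 3 → Bool)
    (hg : IsSeparating fun x : Fin 2 × Corner => g x.1 x.2)
    (hh : IsSeparating fun x : Fin 2 × Corner => h x.1 x.2)
    (gram : ∀ t t' c c', symp (g t c) (g t' c') =
      symp (h t (cornerSym π f c)) (h t' (cornerSym π f c'))) :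
    Equivalent (stabilizerGroup g) (stabilizerGroup h) := by
  obtain ⟨u, hu, hgh⟩ := exists_symplectic (g := fun x : Fin 2 × Corner => g x.1 x.2)
    (h := fun x => h x.1 (cornerSym π f x.2)) hg
    (fun E hE => hh E fun x => by simpa using hE (x.1, (cornerSym π f).symm x.2))
    (fun x y => gram x.1 y.1 x.2 y.2)
  refine ⟨π, f, u, hu, ?_⟩
  rw [map_stabilizerGroup]
  congr 1
  funext t c
  simpa using (hgh (t, (cornerSym π f).symm c)).symm

theorem IsSymplectic.comp {m : ℕ} {u v : OnSite m ≃ₗ[ZMod 2] OnSite m} (hu : IsSymplectic u)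
    (hv : IsSymplectic v) : IsSymplectic (v.trans u) := fun a b => by
  simp only [LinearEquiv.trans_apply, hu _ _, hv _ _]

theorem IsSymplectic.symm {m : ℕ} {u : OnSite m ≃ₗ[ZMod 2] OnSite m} (hu : IsSymplectic u) :
    IsSymplectic u.symm := fun a b => by
  rw [← hu, LinearEquiv.apply_symm_apply, LinearEquiv.apply_symm_apply]

/-- Being CSS with respect to some symplectic basis is invariant under equivalence. -/
theorem IsCSS.of_equivalent {m : ℕ} {S S' : AddSubgroup (FinitePauli m)} (hS : IsCSS S)
    (h : Equivalent S S') : IsCSS S' := by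
  obtain ⟨π, f, u, hu, rfl⟩ := h
  obtain ⟨v, hv, hS⟩ := hS
  refine ⟨u.symm.trans v, hv.comp hu.symm, ?_⟩
  have key : ∀ (x : FinitePauli m) (P : OnSite m → Prop), P 0 → (∀ p, P (v (x p))) →
      ∀ p, P ((u.symm.trans v) (transform π f u x p)) := by
    intro x P h0 hx p
    by_cases hp : p ∈ Set.range (cubeSym π f)
    · obtain ⟨p, rfl⟩ := hp
      simpa [transform_apply] using hx p
    · simpa [transform_apply_of_notMem_range π f u x hp] using h0
  rintro _ ⟨s, hs, rfl⟩
  obtain ⟨x, hx, z, hz, rfl, hxt, hzt⟩ := hS s hs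
  exact ⟨_, ⟨x, hx, rfl⟩, _, ⟨z, hz, rfl⟩, map_add _ _ _,
    key x (fun a => a.2 = 0) rfl hxt, key z (fun a => a.1 = 0) rfl hzt⟩

/-! ### Stabilizer elements supported on a cube -/

/-- The operator acts trivially outside of the unit cube at the origin. -/
def SupportedOnCube {m : ℕ} (s : FinitePauli m) : Prop :=
  ∀ x, s x ≠ 0 → ∀ i, 0 ≤ x i ∧ x i ≤ 1

theorem cornerSite_nonneg_le_one (c : Corner) (i : Fin 3) :
    0 ≤ cornerSite c i ∧ cornerSite c i ≤ 1 := by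
  simp only [cornerSite]
  omega

theorem supportedOnCube_place {m : ℕ} (q : Corner → OnSite m) :
    SupportedOnCube (place q 0) := by
  intro x hx
  rw [place_apply] at hx
  obtain ⟨c, -, hc⟩ := Finset.exists_ne_zero_of_sum_ne_zero hx
  rw [zero_add, ne_eq, ite_eq_right_iff, Classical.not_imp] at hc
  rw [← hc.1]
  exact cornerSite_nonneg_le_one c

theorem place_zero_cornerSite {m : ℕ} (q : Corner → OnSite m) (c : Corner) :
    place q 0 (cornerSite c) = q c := by
  rw [place_apply, Finset.sum_eq_single c] <;> simp +contextual [cornerSite_injective.eq_iff]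

theorem mem_stabilizerGroup_iff {m : ℕ} {g : Fin 2 → Corner → OnSite m} {s : FinitePauli m}
    (hs : s ∈ stabilizerGroup g) :
    ∃ a : (Fin 2 × Site) →₀ ZMod 2, s = a.sum fun x k => k • place (g x.1) x.2 := by
  have : stabilizerGroup g ≤
      (Submodule.span (ZMod 2) (Set.range fun x : Fin 2 × Site => place (g x.1) x.2)).toAddSubgroup :=
    (AddSubgroup.closure_le _).2 Submodule.subset_span
  obtain ⟨a, ha⟩ := Finsupp.mem_span_range_iff_exists_finsupp.1 (this hs)
  exact ⟨a, ha.symm⟩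

/-- Let `K` be a corner at which the two generators are independent. In a product of translated
generators that is supported on the unit cube, no cube can stick out on the side of `K`:
the operator at the corner `K` of an extremal cube would not be cancelled by the other cubes. -/
theorem translate_bound {m : ℕ} {g : Fin 2 → Corner → OnSite m}
    {a : (Fin 2 × Site) →₀ ZMod 2}
    (hs : SupportedOnCube (a.sum fun x k => k • place (g x.1) x.2)) {K : Corner}
    (hK : ∀ A : Fin 2 → ZMod 2, ∑ t, A t • g t K = 0 → A = 0) (i : Fin 3)
    {x : Fin 2 × Site} (hx : a x ≠ 0) : (2 * cornerSite K i - 1) * x.2 i ≤ 0 := by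
  -- `ε` points from the centre of the cube towards `K`.
  set ε : Fin 3 → ℤ := fun j => 2 * cornerSite K j - 1 with hε
  have hεK : ∀ j (c : Corner), 0 ≤ ε j * (cornerSite K j - cornerSite c j) ∧
      (ε j * (cornerSite K j - cornerSite c j) = 0 → c j = K j) := fun j c => by
    simp only [hε, cornerSite]
    generalize K j = k
    generalize c j = l
    revert k l
    decide
  by_contra! hpos
  change 0 < ε i * x.2 i at hpos
  -- Among the cubes that stick out, take one that is furthest in the direction of `K`.
  obtain ⟨y, hy, hmax⟩ := (a.support.filter fun y => 0 < ε i * y.2 i).exists_max_image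
    (fun y => ∑ j, ε j * y.2 j) ⟨x, by simpa using ⟨hx, hpos⟩⟩
  rw [Finset.mem_filter, Finsupp.mem_support_iff] at hy
  have unique : ∀ z, a z ≠ 0 → ∀ c, z.2 + cornerSite c = y.2 + cornerSite K →
      c = K ∧ z.2 = y.2 := by
    intro z hz c hc
    have hj : ∀ j, ε j * z.2 j = ε j * y.2 j + ε j * (cornerSite K j - cornerSite c j) :=
      fun j => by
        have := congrFun hc j
        simp only [Pi.add_apply] at this
        rw [← mul_add]
        congr 1
        linarith
    have hzi : 0 < ε i * z.2 i := by
      have := (hεK i c).1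
      rw [hj]
      linarith [hy.2]
    have hle := hmax z (by simpa using ⟨hz, hzi⟩)
    simp only [hj, Finset.sum_add_distrib] at hle
    have hzero : ∑ j, ε j * (cornerSite K j - cornerSite c j) = 0 :=
      le_antisymm (by linarith) (Finset.sum_nonneg fun j _ => (hεK j c).1)
    have hcK : c = K := funext fun j => (hεK j c).2
      ((Finset.sum_eq_zero_iff_of_nonneg fun j _ => (hεK j c).1).1 hzero j (Finset.mem_univ j))
    subst hcK
    exact ⟨rfl, add_right_cancel hc⟩
  have hval : (a.sum fun x k => k • place (g x.1) x.2) (y.2 + cornerSite K) =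
      ∑ t, a (t, y.2) • g t K := by
    rw [Finsupp.sum_apply, Finsupp.sum_of_support_subset
      (s := a.support ∪ Finset.univ.image fun t => (t, y.2)) _ Finset.subset_union_left _ (by simp)]
    rw [← Finset.sum_subset (Finset.subset_union_right (s₁ := a.support)),
      Finset.sum_image fun _ _ _ _ h => (Prod.mk.inj h).1]
    · refine Finset.sum_congr rfl fun t _ => ?_
      rw [Finsupp.smul_apply, place_apply, Finset.sum_eq_single K] <;>
        simp +contextual [cornerSite_injective.eq_iff]
    · intro z _ hz
      rw [Finsupp.smul_apply, place_apply, Finset.smul_sum]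
      refine Finset.sum_eq_zero fun c _ => ?_
      split_ifs with hc
      · by_cases haz : a z = 0
        · rw [haz, zero_smul]
        · refine absurd ?_ hz
          rw [Finset.mem_image]
          exact ⟨z.1, Finset.mem_univ _, by rw [← (unique z haz c hc).2]⟩
      · exact smul_zero _
  have hne : (a.sum fun x k => k • place (g x.1) x.2) (y.2 + cornerSite K) ≠ 0 := by
    rw [hval]
    intro h
    exact hy.1 (congrFun (hK (fun t => a (t, y.2)) h) y.1)
  have hbound := hs _ hne i
  have hyi := hy.2
  simp only [Pi.add_apply] at hbound
  rcases cornerSite_nonneg_le_one K i with ⟨h0, h1⟩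
  obtain h | h : cornerSite K i = 0 ∨ cornerSite K i = 1 := by omega
  · rw [h] at hbound
    simp only [hε, h] at hyi
    linarith [hbound.1]
  · rw [h] at hbound
    simp only [hε, h] at hyi
    linarith [hbound.2]

/-- If the generators are independent at two opposite corners, then the stabilizer elements
supported on the unit cube are the products of the generators at that cube. -/
theorem exists_eq_sum_of_supportedOnCube {m : ℕ} {g : Fin 2 → Corner → OnSite m} {K : Corner}
    (hK : ∀ A : Fin 2 → ZMod 2, ∑ t, A t • g t K = 0 → A = 0)
    (hK' : ∀ A : Fin 2 → ZMod 2, ∑ t, A t • g t (antipode K) = 0 → A = 0)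
    {s : FinitePauli m} (hs : s ∈ stabilizerGroup g) (hcube : SupportedOnCube s) :
    ∃ A : Fin 2 → ZMod 2, s = ∑ t, A t • place (g t) 0 := by
  obtain ⟨a, rfl⟩ := mem_stabilizerGroup_iff hs
  have hzero : ∀ x, a x ≠ 0 → x.2 = 0 := fun x hx => by
    funext i
    have h₁ := translate_bound hcube hK i hx
    have h₂ := translate_bound hcube hK' i hx
    have : cornerSite (antipode K) i = 1 - cornerSite K i := rev_fin_two (K i)
    rw [this] at h₂
    rcases cornerSite_nonneg_le_one K i with ⟨h0, h1⟩
    obtain h | h : cornerSite K i = 0 ∨ cornerSite K i = 1 := by omega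
    all_goals
      rw [h] at h₁ h₂
      simp only [Pi.zero_apply]
      linarith
  refine ⟨fun t => a (t, 0), ?_⟩
  rw [Finsupp.sum_of_support_subset (s := Finset.univ.image fun t => (t, (0 : Site))) _ _ _
    (by simp), Finset.sum_image fun _ _ _ _ h => (Prod.mk.inj h).1]
  intro x hx
  rw [Finset.mem_image]
  exact ⟨x.1, Finset.mem_univ _, by rw [← hzero x (Finsupp.mem_support_iff.1 hx)]⟩

/-! ### Binary functions on the corners as bytes -/

/-- `p` holds for all numbers below the bound; a form that the kernel evaluates quickly. -/
def allBelow : ℕ → (ℕ → Bool) → Bool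
  | 0, _ => true
  | n + 1, p => p n && allBelow n p

theorem allBelow_eq_true {n : ℕ} {p : ℕ → Bool} :
    allBelow n p = true ↔ ∀ i < n, p i = true := by
  induction n with
  | zero => simp [allBelow]
  | succ n ih =>
    rw [allBelow, Bool.and_eq_true, ih]
    constructor
    · rintro ⟨h, h'⟩ i hi
      obtain rfl | hi := Nat.lt_succ_iff_lt_or_eq.1 hi |>.symm
      · exact h
      · exact h' i hi
    · exact fun h => ⟨h n n.lt_succ_self, fun i hi => h i (hi.trans n.lt_succ_self)⟩

/-- The corners in lexicographic order, numbered in binary. -/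
def cornerIndex : Corner ≃ Fin 8 where
  toFun c := ⟨4 * c 0 + 2 * c 1 + c 2, by omega⟩
  invFun i := ![⟨i / 4, by omega⟩, ⟨i / 2 % 2, by omega⟩, ⟨i % 2, by omega⟩]
  left_inv := by decide +kernel
  right_inv := by decide +kernel

/-- The number whose binary digits are the values of `w`. -/
def pack (w : Corner → ZMod 2) : ℕ :=
  Nat.ofBits fun i : Fin 8 => decide (w (cornerIndex.symm i) = 1)

theorem pack_lt (w : Corner → ZMod 2) : pack w < 256 :=
  Nat.ofBits_lt_two_pow _

theorem testBit_pack (w : Corner → ZMod 2) (c : Corner) :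
    (pack w).testBit (cornerIndex c) = decide (w c = 1) := by
  rw [pack, Nat.testBit_ofBits_lt _ _ (cornerIndex c).2]
  simp

theorem pack_injective : Function.Injective pack := fun w w' h => by
  have bit_ext : ∀ x y : ZMod 2, decide (x = 1) = decide (y = 1) → x = y := by decide
  funext c
  apply bit_ext
  rw [← testBit_pack, ← testBit_pack, h]

theorem eq_of_testBit_cornerIndex {n n' : ℕ} (hn : n < 256) (hn' : n' < 256)
    (h : ∀ c, n.testBit (cornerIndex c) = n'.testBit (cornerIndex c)) : n = n' := by
  refine Nat.eq_of_testBit_eq fun i => ?_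
  by_cases hi : i < 8
  · simpa using h (cornerIndex.symm ⟨i, hi⟩)
  · have h2 : 2 ^ 8 ≤ 2 ^ i := Nat.pow_le_pow_right (by norm_num) (not_lt.1 hi)
    rw [Nat.testBit_lt_two_pow (hn.trans_le h2), Nat.testBit_lt_two_pow (hn'.trans_le h2)]

theorem decide_add_eq_one (x y : ZMod 2) :
    decide (x + y = 1) = (decide (x = 1) ^^ decide (y = 1)) := by
  revert x y
  decide

theorem pack_add (w w' : Corner → ZMod 2) : pack (w + w') = pack w ^^^ pack w' := by
  refine eq_of_testBit_cornerIndex (pack_lt _)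
    (Nat.xor_lt_two_pow (n := 8) (pack_lt _) (pack_lt _)) fun c => ?_
  rw [Nat.testBit_xor, testBit_pack, testBit_pack, testBit_pack, Pi.add_apply, decide_add_eq_one]

theorem pack_zero : pack 0 = 0 := by decide +kernel

/-- The parity of the byte `n` on the line through the corner with number `i`. The direction of
the line has its nonzero entries at the digits of `m`, and its negative ones at those of `s`. -/
def lineOdd (n m s i : ℕ) : Bool :=
  if i &&& m == s || i &&& m == m ^^^ s then n.testBit i ^^ n.testBit (i ^^^ m) else n.testBit i

/-- The predicate `StringFree` for bytes. -/
def stringFreeByte (n : ℕ) : Bool :=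
  allBelow 8 fun m => allBelow 8 fun s => m == 0 || s &&& m != s ||
    !(allBelow 8 fun i => !(lineOdd n m s i))

/-- The direction that is encoded by `m` and `s` as in `lineOdd`. -/
def direction (m s : ℕ) : Site := fun i =>
  if m.testBit (2 - i) then (if s.testBit (2 - i) then -1 else 1) else 0

theorem exists_direction {v : Site} (hv : ‖v‖ = 1) :
    ∃ m < 8, ∃ s < 8, m ≠ 0 ∧ s &&& m = s ∧ v = direction m s := by
  have hle : ∀ i, v i ∈ ({-1, 0, 1} : Finset ℤ) := fun i => by
    have h := norm_le_pi_norm v i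
    rw [hv, Int.norm_eq_abs] at h
    have h' : |v i| ≤ 1 := by exact_mod_cast h
    rw [abs_le] at h'
    simp only [Finset.mem_insert, Finset.mem_singleton]
    omega
  have all : ∀ x ∈ ({-1, 0, 1} : Finset ℤ), ∀ y ∈ ({-1, 0, 1} : Finset ℤ),
      ∀ z ∈ ({-1, 0, 1} : Finset ℤ), ![x, y, z] ≠ 0 →
      ∃ m < 8, ∃ s < 8, m ≠ 0 ∧ s &&& m = s ∧ ![x, y, z] = direction m s := by
    decide +kernel
  have hvec : v = ![v 0, v 1, v 2] := by
    funext i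
    fin_cases i <;> rfl
  rw [hvec]
  refine all _ (hle 0) _ (hle 1) _ (hle 2) ?_
  rw [← hvec]
  rintro rfl
  simp at hv

theorem norm_direction {m s : ℕ} (hm : m < 8) (hm0 : m ≠ 0) : ‖direction m s‖ = 1 := by
  refine le_antisymm ((pi_norm_le_iff_of_nonneg zero_le_one).2 fun i => ?_) ?_
  · unfold direction
    split_ifs <;> simp
  · have : ∀ m < 8, m ≠ 0 → ∃ i : Fin 3, m.testBit (2 - i) = true := by decide
    obtain ⟨i, hi⟩ := this m hm hm0
    refine le_trans ?_ (norm_le_pi_norm _ i)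
    simp only [direction, hi, if_true]
    split_ifs <;> simp

set_option synthInstance.maxSize 1000 in
/-- A line of norm one through a corner of the cube contains at most one other corner. -/
theorem exists_cornerSite_eq_iff {m s : ℕ} (hm : m < 8) (hs : s < 8) (hm0 : m ≠ 0)
    (hsm : s &&& m = s) (c₀ c : Corner) :
    (∃ n : ℤ, cornerSite c = cornerSite c₀ + n • direction m s) ↔
      c = c₀ ∨ ((((cornerIndex c₀ : ℕ) &&& m) = s ∨ ((cornerIndex c₀ : ℕ) &&& m) = m ^^^ s) ∧
        (cornerIndex c : ℕ) = cornerIndex c₀ ^^^ m) := by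
  have hfin : (∃ n : ℤ, cornerSite c = cornerSite c₀ + n • direction m s) ↔
      ∃ n ∈ ({-1, 0, 1} : Finset ℤ), cornerSite c = cornerSite c₀ + n • direction m s := by
    refine ⟨fun ⟨n, hn⟩ => ⟨n, ?_, hn⟩, fun ⟨n, _, hn⟩ => ⟨n, hn⟩⟩
    have : ∀ m < 8, m ≠ 0 → ∃ i : Fin 3, m.testBit (2 - i) = true := by decide
    obtain ⟨i, hi⟩ := this m hm hm0
    have hni := congrFun hn i
    simp only [Pi.add_apply, Pi.smul_apply, smul_eq_mul, direction, hi, if_true] at hni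
    have h₁ := cornerSite_nonneg_le_one c i
    have h₂ := cornerSite_nonneg_le_one c₀ i
    simp only [Finset.mem_insert, Finset.mem_singleton]
    split_ifs at hni <;> omega
  rw [hfin]
  have all : ∀ m < 8, ∀ s < 8, m ≠ 0 → s &&& m = s → ∀ c₀ c : Corner,
      ((∃ n ∈ ({-1, 0, 1} : Finset ℤ), cornerSite c = cornerSite c₀ + n • direction m s) ↔
      c = c₀ ∨ ((((cornerIndex c₀ : ℕ) &&& m) = s ∨ ((cornerIndex c₀ : ℕ) &&& m) = m ^^^ s) ∧
        (cornerIndex c : ℕ) = cornerIndex c₀ ^^^ m)) := by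
    decide +kernel
  exact all m hm s hs hm0 hsm c₀ c

theorem lineSum_direction_ne_zero {m s : ℕ} (hm : m < 8) (hs : s < 8) (hm0 : m ≠ 0)
    (hsm : s &&& m = s) (w : Corner → ZMod 2) (c₀ : Corner) :
    lineSum (direction m s) w c₀ ≠ 0 ↔ lineOdd (pack w) m s (cornerIndex c₀) = true := by
  have ne_zero_iff : ∀ x : ZMod 2, x ≠ 0 ↔ decide (x = 1) = true := by decide
  have hlt : (cornerIndex c₀ : ℕ) ^^^ m < 8 :=
    Nat.xor_lt_two_pow (n := 3) (cornerIndex c₀).2 hm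
  set c₁ : Corner := cornerIndex.symm ⟨cornerIndex c₀ ^^^ m, hlt⟩ with hc₁
  have hidx : ∀ c, (cornerIndex c : ℕ) = cornerIndex c₀ ^^^ m ↔ c = c₁ := fun c => by
    rw [hc₁, Equiv.eq_symm_apply, Fin.ext_iff]
  have hne : c₁ ≠ c₀ := fun h => by
    rw [eq_comm, ← hidx] at h
    exact hm0 (by simpa using h.symm)
  rw [lineSum]
  simp only [exists_cornerSite_eq_iff hm hs hm0 hsm, hidx, lineOdd, Bool.or_eq_true, beq_iff_eq]
  rw [ne_zero_iff]
  split_ifs with hP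
  · simp only [hP, true_and]
    rw [Finset.sum_ite, Finset.sum_const_zero, add_zero,
      show (Finset.univ.filter fun c => c = c₀ ∨ c = c₁) = {c₀, c₁} by ext; simp,
      Finset.sum_pair hne.symm, decide_add_eq_one, testBit_pack, ← (hidx c₁).2 rfl, testBit_pack]
  · simp only [hP, false_and, or_false, Finset.sum_ite_eq', Finset.mem_univ, if_true,
      testBit_pack]

theorem stringFree_iff (w : Corner → ZMod 2) :
    StringFree w ↔ stringFreeByte (pack w) = true := by
  simp only [stringFreeByte, allBelow_eq_true, Bool.or_eq_true, Bool.not_eq_true',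
    beq_iff_eq, bne_iff_ne, Bool.eq_false_iff, ne_eq, not_forall]
  constructor
  · intro h m hm s hs
    by_cases hm0 : m = 0
    · exact Or.inl (Or.inl hm0)
    by_cases hsm : s &&& m = s
    · obtain ⟨c₀, hc⟩ := h _ (norm_direction (s := s) hm hm0)
      rw [lineSum_direction_ne_zero hm hs hm0 hsm] at hc
      exact Or.inr ⟨_, (cornerIndex c₀).2, by simpa using hc⟩
    · exact Or.inl (Or.inr hsm)
  · intro h v hv
    obtain ⟨m, hm, s, hs, hm0, hsm, rfl⟩ := exists_direction hv
    obtain (h | h) | ⟨i, hi, h⟩ := h m hm s hs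
    · exact absurd h hm0
    · exact absurd hsm h
    · refine ⟨cornerIndex.symm ⟨i, hi⟩, (lineSum_direction_ne_zero hm hs hm0 hsm _ _).2 ?_⟩
      simpa using h

/-- The set of bytes that satisfy `stringFreeByte`, as the binary digits of a number. -/
def stringFreeBytes : ℕ :=
  0x6bd6bfffdfff6ff6f7ff7bdefdfefee9ff7fffbe7bdefee96ff6fee9fee96996

theorem testBit_stringFreeBytes {n : ℕ} (hn : n < 256) :
    stringFreeBytes.testBit n = stringFreeByte n := by
  have : allBelow 256 (fun n => stringFreeBytes.testBit n == stringFreeByte n) = true := by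
    decide +kernel
  simpa using allBelow_eq_true.1 this n hn

theorem StringFree.testBit {w : Corner → ZMod 2} (h : StringFree w) :
    stringFreeBytes.testBit (pack w) = true := by
  rw [testBit_stringFreeBytes (pack_lt w), ← stringFree_iff]
  exact h

/-! ### Commutation relations of translated cubes -/

/-- Overlaps of the cube with its translate by a vector of norm at most one. -/
theorem sum_overlap {m s : Fin 8} (hsm : s &&& m = s) (F : Corner → Corner → ZMod 2) :
    (∑ c, ∑ c', if cornerSite c = direction m s + cornerSite c' then F c c' else 0) =
      ∑ i : Fin 8, if i &&& m = m ^^^ s then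
        F (cornerIndex.symm i) (cornerIndex.symm (i ^^^ m)) else 0 := by
  have all : ∀ m s : Fin 8, s &&& m = s → ∀ c c',
      (cornerSite c = direction m s + cornerSite c' ↔
        cornerIndex c &&& m = m ^^^ s ∧ c' = cornerIndex.symm (cornerIndex c ^^^ m)) := by
    decide +kernel
  refine Fintype.sum_equiv cornerIndex _ _ fun c => ?_
  simp only [all m s hsm, ite_and, Equiv.symm_apply_apply]
  split_ifs
  · simp
  · simp

/-! ### Classification of the codes of inversion form -/

theorem decide_eq_one_of_add_eq_zero {x y : ZMod 2} (h : x + y = 0) :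
    decide (y = 1) = decide (x = 1) := by
  revert x y
  decide

theorem decide_eq_one_of_add_add_add_eq_zero {x y z w : ZMod 2} (h : x + y + z + w = 0) :
    decide (w = 1) = (decide (x = 1) ^^ decide (y = 1) ^^ decide (z = 1)) := by
  revert x y z w
  decide

/-- The number with the given binary digits, the lowest one first. -/
def byte (b₀ b₁ b₂ b₃ b₄ b₅ b₆ b₇ : Bool) : ℕ :=
  Nat.ofBits ![b₀, b₁, b₂, b₃, b₄, b₅, b₆, b₇]

theorem pack_eq_byte (w : Corner → ZMod 2) : pack w =
    byte (decide (w (cornerIndex.symm 0) = 1)) (decide (w (cornerIndex.symm 1) = 1))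
      (decide (w (cornerIndex.symm 2) = 1)) (decide (w (cornerIndex.symm 3) = 1))
      (decide (w (cornerIndex.symm 4) = 1)) (decide (w (cornerIndex.symm 5) = 1))
      (decide (w (cornerIndex.symm 6) = 1)) (decide (w (cornerIndex.symm 7) = 1)) := by
  unfold pack byte
  congr 1
  funext i
  fin_cases i <;> rfl

/-- The byte is zero or satisfies `StringFree`. -/
def zeroOrStringFree (n : ℕ) : Bool := n == 0 || stringFreeBytes.testBit n

/-- All sums of `x` with some of the rows pass `zeroOrStringFree`. -/
def spanCheck : List ℕ → ℕ → Bool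
  | [], x => zeroOrStringFree x
  | r :: rows, x => spanCheck rows x && spanCheck rows (x ^^^ r)

theorem spanCheck_eq_true {X : Set ℕ} (hxor : ∀ x ∈ X, ∀ y ∈ X, x ^^^ y ∈ X)
    (hX : ∀ x ∈ X, zeroOrStringFree x = true) (rows : List ℕ) (hrows : ∀ r ∈ rows, r ∈ X)
    {x : ℕ} (hx : x ∈ X) : spanCheck rows x = true := by
  induction rows generalizing x with
  | nil => exact hX x hx
  | cons r rows ih =>
    have hrows' : ∀ r ∈ rows, r ∈ X := fun r hr => hrows r (List.mem_cons_of_mem _ hr)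
    rw [spanCheck, ih hrows' hx, ih hrows' (hxor x hx r (hrows r List.mem_cons_self))]
    rfl

/-- The rows of a matrix that is indexed by the corners. -/
def packedRows (M : Corner → Corner → ZMod 2) : List ℕ :=
  [0, 1, 2, 3, 4, 5, 6, 7].map fun i : Fin 8 => pack (M (cornerIndex.symm i))

theorem mem_packedRows (M : Corner → Corner → ZMod 2) (c : Corner) : pack (M c) ∈ packedRows M := by
  refine List.mem_map.2 ⟨cornerIndex c, ?_, by simp⟩
  generalize cornerIndex c = i
  revert i
  decide

theorem packedRows_injective : Function.Injective packedRows := fun M M' h => by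
  funext c
  have key : ∀ i : Fin 8, pack (M (cornerIndex.symm i)) = pack (M' (cornerIndex.symm i)) := by
    simp only [packedRows, List.map_cons, List.map_nil, List.cons.injEq, and_true] at h
    obtain ⟨h₀, h₁, h₂, h₃, h₄, h₅, h₆, h₇⟩ := h
    intro i
    fin_cases i
    exacts [h₀, h₁, h₂, h₃, h₄, h₅, h₆, h₇]
  simpa using pack_injective (key (cornerIndex c))

/-- The commutation matrix of the first generator of code `0`. -/
def tableGram (c c' : Corner) : ZMod 2 := symp (firstGenerator 0 c) (firstGenerator 0 c')

/-- The reflections of the cube, numbered in binary. -/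
def reflection (n : ℕ) (i : Fin 3) : Bool := n.testBit i

/-- The rows are those of `tableGram` up to a symmetry of the cube. It suffices to try 16 symmetries,
because `tableGram` is invariant under a rotation of order three. -/
def isTableGram (rows : List ℕ) : Bool :=
  [1, Equiv.swap 0 1].any fun π => !(allBelow 8 fun n => !(rows ==
    packedRows fun c c' => tableGram (cornerSym π (reflection n) c) (cornerSym π (reflection n) c')))

theorem exists_of_isTableGram {M : Corner → Corner → ZMod 2}
    (h : isTableGram (packedRows M) = true) :
    ∃ π f, ∀ c c', M c c' = tableGram (cornerSym π f c) (cornerSym π f c') := by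
  rw [isTableGram, List.any_eq_true] at h
  obtain ⟨π, -, h⟩ := h
  rw [Bool.not_eq_true', Bool.eq_false_iff, ne_eq, allBelow_eq_true] at h
  push Not at h
  obtain ⟨n, -, h⟩ := h
  simp only [ne_eq, Bool.not_eq_true', Bool.not_eq_false, beq_iff_eq] at h
  exact ⟨π, reflection n, fun c c' => congrFun (congrFun (packedRows_injective h) c) c'⟩

/-- `p` holds for both truth values. -/
def forallBool (p : Bool → Bool) : Bool := p false && p true

theorem forallBool_eq_true {p : Bool → Bool} : forallBool p = true ↔ ∀ b, p b = true := by
  simp [forallBool]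

/-- The rows of the alternating matrix with vanishing sums along the translates of the edges,
the face diagonals and the body diagonals of the cube. Such a matrix is determined by its
entries at three edges of each direction and at one face diagonal of each direction. -/
def altRows (e01 e02 e04 f03 f05 f06 e37 e57 e67 f12 f14 f24 e15 e13 e23 : Bool) : List ℕ :=
  [byte false e01 e02 f03 e04 f05 f06 false,
    byte e01 false f12 e13 f14 e15 false f06,
    byte e02 f12 false e23 f24 false (e04 ^^ e15 ^^ e37) f05,
    byte f03 e13 e23 false false f24 f14 e37,
    byte e04 f14 f24 false false (e01 ^^ e23 ^^ e67) (e02 ^^ e13 ^^ e57) f03,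
    byte f05 e15 false f24 (e01 ^^ e23 ^^ e67) false f12 e57,
    byte f06 false (e04 ^^ e15 ^^ e37) f14 (e02 ^^ e13 ^^ e57) f12 false e67,
    byte false f06 f05 e37 f03 e57 e67 false]

/-- If all sums of the rows of an alternating matrix as in `altRows` are zero or string-free, then
the matrix is zero or is `tableGram` up to a symmetry of the cube. The first and the last row are
checked early in order to prune the search. -/
def altRowsCheck : Bool :=
  forallBool fun e01 => forallBool fun e02 => forallBool fun e04 =>
  forallBool fun f03 => forallBool fun f05 => forallBool fun f06 =>
  !(zeroOrStringFree (byte false e01 e02 f03 e04 f05 f06 false)) ||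
  forallBool fun e37 => forallBool fun e57 => forallBool fun e67 =>
  !(spanCheck [byte false e01 e02 f03 e04 f05 f06 false, byte false f06 f05 e37 f03 e57 e67 false]
    0) ||
  forallBool fun f12 => forallBool fun f14 => forallBool fun f24 =>
  forallBool fun e15 => forallBool fun e13 => forallBool fun e23 =>
  !(spanCheck (altRows e01 e02 e04 f03 f05 f06 e37 e57 e67 f12 f14 f24 e15 e13 e23) 0) ||
  altRows e01 e02 e04 f03 f05 f06 e37 e57 e67 f12 f14 f24 e15 e13 e23 == [0, 0, 0, 0, 0, 0, 0, 0] ||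
  isTableGram (altRows e01 e02 e04 f03 f05 f06 e37 e57 e67 f12 f14 f24 e15 e13 e23)

theorem altRowsCheck_eq_true : altRowsCheck = true := by
  decide +kernel

/-- The commutation matrix of a cube operator that commutes with its translates is one of the
matrices `altRows`. -/
theorem exists_packedRows_eq_altRows {m : ℕ} {q : Corner → OnSite m} (hq : Commuting q q) :
    ∃ e01 e02 e04 f03 f05 f06 e37 e57 e67 f12 f14 f24 e15 e13 e23,
      packedRows (fun c c' => symp (q c) (q c')) =
        altRows e01 e02 e04 f03 f05 f06 e37 e57 e67 f12 f14 f24 e15 e13 e23 := by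
  set M : Fin 8 → Fin 8 → ZMod 2 :=
    fun i j => symp (q (cornerIndex.symm i)) (q (cornerIndex.symm j)) with hM
  have rel : ∀ m s : Fin 8, s &&& m = s →
      ∑ i : Fin 8, (if i &&& m = m ^^^ s then M i (i ^^^ m) else 0) = 0 := fun m s hms => by
    rw [← sum_overlap hms fun c c' => symp (q c) (q c')]
    exact hq _
  have hsymm : ∀ i j, M i j = M j i := fun i j => symp_comm _ _
  have hdiag : ∀ i, M i i = 0 := fun i => symp_self _
  have hbody : M 0 7 = 0 ∧ M 1 6 = 0 ∧ M 2 5 = 0 ∧ M 3 4 = 0 := by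
    refine ⟨?_, ?_, ?_, ?_⟩
    · simpa [Fin.sum_univ_eight] using rel 7 7 (by decide)
    · simpa [Fin.sum_univ_eight] using rel 7 6 (by decide)
    · simpa [Fin.sum_univ_eight] using rel 7 5 (by decide)
    · simpa [Fin.sum_univ_eight] using rel 7 4 (by decide)
  have h47 : M 0 3 + M 4 7 = 0 := by simpa [Fin.sum_univ_eight] using rel 3 3 (by decide)
  have h56 : M 1 2 + M 5 6 = 0 := by simpa [Fin.sum_univ_eight] using rel 3 2 (by decide)
  have h27 : M 0 5 + M 2 7 = 0 := by simpa [Fin.sum_univ_eight] using rel 5 5 (by decide)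
  have h36 : M 1 4 + M 3 6 = 0 := by simpa [Fin.sum_univ_eight] using rel 5 4 (by decide)
  have h17 : M 0 6 + M 1 7 = 0 := by simpa [Fin.sum_univ_eight] using rel 6 6 (by decide)
  have h35 : M 2 4 + M 3 5 = 0 := by simpa [Fin.sum_univ_eight] using rel 6 4 (by decide)
  have h26 : M 0 4 + M 1 5 + M 2 6 + M 3 7 = 0 := by
    simpa [Fin.sum_univ_eight] using rel 4 4 (by decide)
  have h46 : M 0 2 + M 1 3 + M 4 6 + M 5 7 = 0 := by
    simpa [Fin.sum_univ_eight] using rel 2 2 (by decide)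
  have h45 : M 0 1 + M 2 3 + M 4 5 + M 6 7 = 0 := by
    simpa [Fin.sum_univ_eight] using rel 1 1 (by decide)
  rw [add_right_comm] at h26 h46 h45
  set D : Fin 8 → Fin 8 → Bool := fun i j => decide (M i j = 1) with hD
  have Dsymm : ∀ i j, j < i → D i j = D j i := fun i j _ => by simp only [hD, hsymm i j]
  have Ddiag : ∀ i, D i i = false := fun i => by simp [hD, hdiag]
  have D07 : D 0 7 = false := by simp [hD, hbody]
  have D16 : D 1 6 = false := by simp [hD, hbody]
  have D25 : D 2 5 = false := by simp [hD, hbody]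
  have D34 : D 3 4 = false := by simp [hD, hbody]
  have D47 : D 4 7 = D 0 3 := decide_eq_one_of_add_eq_zero h47
  have D56 : D 5 6 = D 1 2 := decide_eq_one_of_add_eq_zero h56
  have D27 : D 2 7 = D 0 5 := decide_eq_one_of_add_eq_zero h27
  have D36 : D 3 6 = D 1 4 := decide_eq_one_of_add_eq_zero h36
  have D17 : D 1 7 = D 0 6 := decide_eq_one_of_add_eq_zero h17
  have D35 : D 3 5 = D 2 4 := decide_eq_one_of_add_eq_zero h35
  have D26 : D 2 6 = (D 0 4 ^^ D 1 5 ^^ D 3 7) := decide_eq_one_of_add_add_add_eq_zero h26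
  have D46 : D 4 6 = (D 0 2 ^^ D 1 3 ^^ D 5 7) := decide_eq_one_of_add_add_add_eq_zero h46
  have D45 : D 4 5 = (D 0 1 ^^ D 2 3 ^^ D 6 7) := decide_eq_one_of_add_add_add_eq_zero h45
  refine ⟨D 0 1, D 0 2, D 0 4, D 0 3, D 0 5, D 0 6, D 3 7, D 5 7, D 6 7, D 1 2, D 1 4, D 2 4,
    D 1 5, D 1 3, D 2 3, ?_⟩
  have hrow : ∀ i : Fin 8,
      pack (fun c' => symp (q (cornerIndex.symm i)) (q c')) =
        byte (D i 0) (D i 1) (D i 2) (D i 3) (D i 4) (D i 5) (D i 6) (D i 7) := fun i =>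
    pack_eq_byte _
  simp only [packedRows, List.map_cons, List.map_nil, hrow, altRows, Ddiag, D07, D16, D25, D34,
    Dsymm 1 0 (by decide), Dsymm 2 0 (by decide), Dsymm 2 1 (by decide), Dsymm 3 0 (by decide),
    Dsymm 3 1 (by decide), Dsymm 3 2 (by decide), Dsymm 4 0 (by decide), Dsymm 4 1 (by decide),
    Dsymm 4 2 (by decide), Dsymm 4 3 (by decide), Dsymm 5 0 (by decide), Dsymm 5 1 (by decide),
    Dsymm 5 2 (by decide), Dsymm 5 3 (by decide), Dsymm 5 4 (by decide), Dsymm 6 0 (by decide),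
    Dsymm 6 1 (by decide), Dsymm 6 2 (by decide), Dsymm 6 3 (by decide), Dsymm 6 4 (by decide),
    Dsymm 6 5 (by decide), Dsymm 7 0 (by decide), Dsymm 7 1 (by decide), Dsymm 7 2 (by decide),
    Dsymm 7 3 (by decide), Dsymm 7 4 (by decide), Dsymm 7 5 (by decide), Dsymm 7 6 (by decide),
    D47, D56, D27, D36, D17, D35, D26, D46, D45]

/-- Up to a symmetry of the cube, the commutation relations within a nontrivial self-commuting
cube operator without strings of period one are those of code `0`. -/
theorem exists_gram_eq_tableGram {m : ℕ} {q : Corner → OnSite m} (hq : Commuting q q)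
    (hfree : ∀ E, E ≠ 0 → StringFree fun c => symp (q c) E)
    (hne : ∃ c c', symp (q c) (q c') ≠ 0) :
    ∃ π f, ∀ c c', symp (q c) (q c') = tableGram (cornerSym π f c) (cornerSym π f c') := by
  obtain ⟨e01, e02, e04, f03, f05, f06, e37, e57, e67, f12, f14, f24, e15, e13, e23, hrows⟩ :=
    exists_packedRows_eq_altRows hq
  set X : Set ℕ := Set.range fun E => pack fun c => symp (q c) E with hX
  have hxor : ∀ x ∈ X, ∀ y ∈ X, x ^^^ y ∈ X := by
    rintro _ ⟨E, rfl⟩ _ ⟨E', rfl⟩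
    refine ⟨E + E', ?_⟩
    simp only
    rw [← pack_add]
    congr 1
    funext c
    exact symp_add_right _ _ _
  have hgood : ∀ x ∈ X, zeroOrStringFree x = true := by
    rintro _ ⟨E, rfl⟩
    by_cases hE : E = 0
    · subst hE
      simp only [symp_zero_right]
      exact (congrArg zeroOrStringFree pack_zero).trans rfl
    · exact Bool.or_eq_true_iff.2 (Or.inr (hfree E hE).testBit)
  have hzero : 0 ∈ X := ⟨0, by
    simp only [symp_zero_right]
    exact pack_zero⟩
  have hrowX : ∀ r ∈ altRows e01 e02 e04 f03 f05 f06 e37 e57 e67 f12 f14 f24 e15 e13 e23,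
      r ∈ X := by
    intro r hr
    rw [← hrows, packedRows, List.mem_map] at hr
    obtain ⟨i, -, rfl⟩ := hr
    exact ⟨q (cornerIndex.symm i), congrArg pack (funext fun c => symp_comm _ _)⟩
  have hcheck := altRowsCheck_eq_true
  simp only [altRowsCheck, forallBool_eq_true] at hcheck
  have h₁ := hcheck e01 e02 e04 f03 f05 f06
  rw [hgood _ (hrowX _ List.mem_cons_self), Bool.not_true, Bool.false_or] at h₁
  simp only [forallBool_eq_true] at h₁
  have h₂ := h₁ e37 e57 e67
  rw [spanCheck_eq_true hxor hgood _ (fun r hr => hrowX r ?_) hzero, Bool.not_true,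
    Bool.false_or] at h₂
  · simp only [forallBool_eq_true] at h₂
    have h₃ := h₂ f12 f14 f24 e15 e13 e23
    rw [spanCheck_eq_true hxor hgood _ hrowX hzero, Bool.not_true, Bool.false_or, ← hrows,
      Bool.or_eq_true, beq_iff_eq] at h₃
    refine exists_of_isTableGram (h₃.resolve_left fun h => ?_)
    obtain ⟨c, c', hc⟩ := hne
    have hmem := mem_packedRows (fun c c' => symp (q c) (q c')) c
    rw [h] at hmem
    have h0 : pack (fun c' => symp (q c) (q c')) = pack 0 := by
      rw [pack_zero]
      simpa using hmem
    exact hc (congrFun (pack_injective h0) c')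
  · simp only [altRows, List.mem_cons, List.not_mem_nil, or_false] at hr ⊢
    rcases hr with rfl | rfl
    · exact Or.inl rfl
    · simp

/-- The commutation relations among the generators of a code of inversion form are determined
by those within the first generator. -/
theorem gram_of_inversion {m n : ℕ} {g : Fin 2 → Corner → OnSite m}
    {h : Fin 2 → Corner → OnSite n} (hg : ∀ c, g 1 c = g 0 (antipode c))
    (hh : ∀ c, h 1 c = h 0 (antipode c)) (π : Equiv.Perm (Fin 3)) (f : Fin 3 → Bool)
    (gram : ∀ c c', symp (g 0 c) (g 0 c') =
      symp (h 0 (cornerSym π f c)) (h 0 (cornerSym π f c'))) (t t' : Fin 2) (c c' : Corner) :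
    symp (g t c) (g t' c') = symp (h t (cornerSym π f c)) (h t' (cornerSym π f c')) := by
  fin_cases t <;> fin_cases t' <;> simp [hg, hh, gram, cornerSym_antipode]

/-- For a code of inversion form, admissibility excludes strings for each generator. -/
theorem IsAdmissible.stringFree_of_inversion {m : ℕ} {g : Fin 2 → Corner → OnSite m}
    (h : IsAdmissible (stabilizerGroup g)) (hg : ∀ c, g 1 c = g 0 (antipode c)) {E : OnSite m}
    (hE : E ≠ 0) : StringFree fun c => symp (g 0 c) E := fun v hv => by
  obtain ⟨t, c₀, hc⟩ := h.exists_lineSum_ne_zero hE hv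
  obtain rfl | rfl : t = 0 ∨ t = 1 := by omega
  · exact ⟨c₀, hc⟩
  · simp only [hg] at hc
    have hneg : cubeSymLinear 1 (fun _ => true) v = -v := rfl
    have := lineSum_comp_cornerSym 1 (fun _ => true) v (fun c => symp (g 0 c) E) c₀
    rw [hneg, lineSum_neg] at this
    exact ⟨_, this ▸ hc⟩

/-- The corner operators of a code of inversion form do not all commute. -/
theorem IsAdmissible.exists_gram_ne_zero {m : ℕ} {g : Fin 2 → Corner → OnSite m}
    (h : IsAdmissible (stabilizerGroup g)) (hg : ∀ c, g 1 c = g 0 (antipode c)) (hm : m ≠ 0) :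
    ∃ c c', symp (g 0 c) (g 0 c') ≠ 0 := by
  have sep : ∀ E, (∀ c, symp (g 0 c) E = 0) → E = 0 := fun E hE => h.isSeparating E fun x => by
    obtain ⟨t, c⟩ := x
    obtain rfl | rfl : t = 0 ∨ t = 1 := by omega
    · exact hE c
    · simpa only [hg] using hE _
  by_contra! hc
  have hzero : ∀ c, g 0 c = 0 := fun c => sep _ fun c' => hc c' c
  have : NeZero m := ⟨hm⟩
  have hone := sep ((fun _ => 1), 0) fun c => by rw [hzero, symp_zero_left]
  exact one_ne_zero (congrFun (congrArg Prod.fst hone) 0)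

/-- The commutation matrix of code `0` has eight distinct rows, so its corner operators are
distinct. On one qubit there are only four operators. -/
theorem not_isInversionCubicCode_one (S : AddSubgroup (FinitePauli 1)) :
    ¬ IsInversionCubicCode S := by
  rintro ⟨h, g, rfl, hg⟩
  obtain ⟨π, f, hgram⟩ := exists_gram_eq_tableGram
    ((stabilizerGroup_commutes_iff.1 h.commutes) 0 0)
    (fun E hE => h.stringFree_of_inversion hg hE) (h.exists_gram_ne_zero hg one_ne_zero)
  obtain ⟨c, c', hne, heq⟩ := Fintype.exists_ne_map_eq_of_card_lt (g 0) (by decide)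
  have rows_ne : ∀ c c', c ≠ c' → pack (tableGram c) ≠ pack (tableGram c') := by
    decide +kernel
  refine rows_ne _ _ ((cornerSym π f).injective.ne hne) (congrArg pack (funext fun d => ?_))
  obtain ⟨d, rfl⟩ := (cornerSym π f).surjective d
  rw [← hgram, ← hgram, heq]

/-! ### The listed codes -/

theorem commuting_tableGenerators (k : Fin 18) (t t' : Fin 2) :
    Commuting (tableGenerators k t) (tableGenerators k t') := by
  have all : ∀ k t t', ∀ m s : Fin 8, s &&& m = s →
      ∑ i : Fin 8, (if i &&& m = m ^^^ s then symp (tableGenerators k t (cornerIndex.symm i))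
        (tableGenerators k t' (cornerIndex.symm (i ^^^ m))) else 0) = 0 := by
    decide +kernel
  have hdir : ∀ m s : Fin 8, s &&& m = s → ∀ d, d = direction m s →
      ∑ c, ∑ c', (if cornerSite c = d + cornerSite c' then
        symp (tableGenerators k t c) (tableGenerators k t' c') else 0) = 0 := by
    rintro m s hms _ rfl
    exact (sum_overlap hms fun c c' => symp (tableGenerators k t c) (tableGenerators k t' c')).trans
      (all k t t' m s hms)
  intro d
  by_cases hd : ∃ c c', cornerSite c = d + cornerSite c'
  · obtain ⟨c, c', hc⟩ := hd
    by_cases hd0 : d = 0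
    · exact hdir 0 0 rfl d (by rw [hd0]; decide +kernel)
    · have hnorm : ‖d‖ = 1 := by
        have hle : ∀ i, |d i| ≤ 1 := fun i => by
          have h₁ := cornerSite_nonneg_le_one c i
          have h₂ := cornerSite_nonneg_le_one c' i
          have h₃ := congrFun hc i
          rw [Pi.add_apply] at h₃
          rw [abs_le]
          omega
        refine le_antisymm ((pi_norm_le_iff_of_nonneg zero_le_one).2 fun i => ?_) ?_
        · rw [Int.norm_eq_abs]
          exact_mod_cast hle i
        · obtain ⟨i, hi⟩ := Function.ne_iff.1 hd0
          refine le_trans ?_ (norm_le_pi_norm d i)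
          rw [Int.norm_eq_abs]
          exact_mod_cast Int.one_le_abs hi
      obtain ⟨m, hm, s, hs, -, hsm, hdms⟩ := exists_direction hnorm
      have hms : (⟨s, hs⟩ : Fin 8) &&& ⟨m, hm⟩ = ⟨s, hs⟩ := by
        apply Fin.ext
        rw [Fin.and_val]
        exact hsm
      exact hdir ⟨m, hm⟩ ⟨s, hs⟩ hms d hdms
  · push Not at hd
    exact Finset.sum_eq_zero fun c _ => Finset.sum_eq_zero fun c' _ => if_neg (hd c c')

theorem isAdmissible_tableCode (k : Fin 18) : IsAdmissible (tableCode k) := by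
  refine isAdmissible_of_generators (Or.inr rfl) (commuting_tableGenerators k) fun E hE => ?_
  have all : ∀ k, ∀ E : OnSite 2, E ≠ 0 → ∃ t,
      stringFreeBytes.testBit (pack fun c => symp (tableGenerators k t c) E) = true := by
    decide +kernel
  obtain ⟨t, ht⟩ := all k E hE
  rw [testBit_stringFreeBytes (pack_lt _)] at ht
  exact ⟨t, (stringFree_iff _).2 ht⟩

theorem isInversionCubicCode_tableCode_zero : IsInversionCubicCode (tableCode 0) :=
  ⟨isAdmissible_tableCode 0, _, rfl, fun _ => rfl⟩

theorem tableGenerators_zero_fst {k : Fin 18} (hk : k ≠ 0) (c : Corner) :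
    (tableGenerators k 0 c).1 = 0 := by
  revert k c
  decide +kernel

theorem tableGenerators_one_snd {k : Fin 18} (hk : k ≠ 0) (c : Corner) :
    (tableGenerators k 1 c).2 = 0 := by
  revert k c
  decide +kernel

theorem isCSSCubicCode_tableCode {k : Fin 18} (hk : k ≠ 0) : IsCSSCubicCode (tableCode k) := by
  have all : ∀ k : Fin 18, k ≠ 0 → ∀ t, ∑ c, tableGenerators k t c = 0 := by
    decide +kernel
  exact ⟨isAdmissible_tableCode k, _, rfl, tableGenerators_zero_fst hk,
    tableGenerators_one_snd hk, all k hk⟩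

theorem isSeparating_tableGenerators (k : Fin 18) :
    IsSeparating fun x : Fin 2 × Corner => tableGenerators k x.1 x.2 :=
  (isAdmissible_tableCode k).isSeparating

theorem equivalent_tableCode_zero {S : AddSubgroup (FinitePauli 2)}
    (hS : IsInversionCubicCode S) : Equivalent S (tableCode 0) := by
  obtain ⟨h, g, rfl, hg⟩ := hS
  obtain ⟨π, f, gram⟩ := exists_gram_eq_tableGram
    (stabilizerGroup_commutes_iff.1 h.commutes 0 0)
    (fun E hE => h.stringFree_of_inversion hg hE) (h.exists_gram_ne_zero hg two_ne_zero)
  exact equivalent_of_gram π f h.isSeparating (isSeparating_tableGenerators 0)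
    (gram_of_inversion hg (fun _ => rfl) π f gram)

/-- A stabilizer element of a listed code that is supported on the unit cube is a product of the
two generators there: they are independent at the corners `A` and `A'`. -/
theorem exists_eq_sum_of_mem_tableCode {k : Fin 18} {s : FinitePauli 2} (hs : s ∈ tableCode k)
    (hcube : SupportedOnCube s) :
    ∃ A : Fin 2 → ZMod 2, s = ∑ t, A t • place (tableGenerators k t) 0 := by
  have all : ∀ k, ∀ K ∈ ({![1, 0, 1], antipode ![1, 0, 1]} : Finset Corner),
      ∀ A : Fin 2 → ZMod 2, ∑ t, A t • tableGenerators k t K = 0 → A = 0 := by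
    decide +kernel
  exact exists_eq_sum_of_supportedOnCube (K := ![1, 0, 1]) (all k _ (by simp)) (all k _ (by simp)) hs hcube

theorem sum_smul_place_cornerSite {m : ℕ} (g : Fin 2 → Corner → OnSite m) (A : Fin 2 → ZMod 2)
    (c : Corner) : (∑ t, A t • place (g t) 0) (cornerSite c) = ∑ t, A t • g t c := by
  simp [place_zero_cornerSite]

/-- If the first generator were a product of an `X`-type and a `Z`-type stabilizer element, then
these would be supported on the unit cube as well. But in no nontrivial product of the two
generators at a cube do all corner operators commute. -/
theorem not_isCSS_tableCode_zero : ¬ IsCSS (tableCode 0) := by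
  rintro ⟨u, hu, h⟩
  obtain ⟨x, hx, z, hz, hxz, hxt, hzt⟩ := h _ (place_mem (tableGenerators 0) 0 0)
  have noncomm : ∀ A : Fin 2 → ZMod 2, A ≠ 0 → ∃ c c',
      symp (∑ t, A t • tableGenerators 0 t c) (∑ t, A t • tableGenerators 0 t c') ≠ 0 := by
    decide +kernel
  -- The `X` part of the generator is trivial where the generator is.
  have hxcube : SupportedOnCube x := fun p hp => by
    refine supportedOnCube_place (tableGenerators 0 0) p fun h0 => hp ?_
    rw [hxz, Finsupp.add_apply] at h0
    have h1 : u (x p) + u (z p) = 0 := by rw [← map_add, h0, map_zero]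
    refine u.map_eq_zero_iff.1 (Prod.ext ?_ (hxt p))
    simpa [hzt p] using congrArg Prod.fst h1
  have hcomm : ∀ y : FinitePauli 2, ((∀ p, (u (y p)).2 = 0) ∨ ∀ p, (u (y p)).1 = 0) →
      ∀ p p', symp (y p) (y p') = 0 := by
    rintro y (hy | hy) p p' <;> rw [← hu] <;> simp [symp, hy]
  have hzero : ∀ A : Fin 2 → ZMod 2, (∀ p p',
      symp ((∑ t, A t • place (tableGenerators 0 t) 0) p)
        ((∑ t, A t • place (tableGenerators 0 t) 0) p') = 0) → A = 0 := fun A hA => by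
    by_contra hne
    obtain ⟨c, c', hc⟩ := noncomm A hne
    rw [← sum_smul_place_cornerSite, ← sum_smul_place_cornerSite] at hc
    exact hc (hA _ _)
  obtain ⟨A, rfl⟩ := exists_eq_sum_of_mem_tableCode hx hxcube
  obtain rfl := hzero A (hcomm _ (Or.inl hxt))
  simp only [Pi.zero_apply, zero_smul, Finset.sum_const_zero, zero_add] at hxz
  have := hzero (Pi.single 0 1) (by
    have := hcomm z (Or.inr hzt)
    rw [← hxz] at this
    simpa [Fin.sum_univ_two] using this)
  simpa using congrFun this 0

/-! ### Inequivalence of the listed codes -/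

/-- The symmetries of the coordinate axes. -/
def axisPerms : List (Equiv.Perm (Fin 3)) :=
  [1, Equiv.swap 0 1, Equiv.swap 0 2, Equiv.swap 1 2, Equiv.swap 0 1 * Equiv.swap 1 2,
    Equiv.swap 1 2 * Equiv.swap 0 1]

theorem mem_axisPerms (π : Equiv.Perm (Fin 3)) : π ∈ axisPerms := by
  revert π
  decide +kernel

theorem exists_reflection_eq (f : Fin 3 → Bool) : ∃ n < 8, reflection n = f := by
  revert f
  decide +kernel

/-- The byte of `w ∘ σ` in terms of the byte of `w`. -/
def permuteByte (σ : Corner ≃ Corner) (n : ℕ) : ℕ :=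
  Nat.ofBits fun i : Fin 8 => n.testBit (cornerIndex (σ (cornerIndex.symm i)))

theorem pack_comp (w : Corner → ZMod 2) (σ : Corner ≃ Corner) :
    pack (fun c => w (σ c)) = permuteByte σ (pack w) := by
  simp only [permuteByte, testBit_pack]
  rfl

/-- The set of the sums of `x` and some of the rows, as the binary digits of a number. -/
def spanSet : List ℕ → ℕ → ℕ
  | [], x => 1 <<< x
  | r :: rows, x => spanSet rows x ||| spanSet rows (x ^^^ r)

theorem testBit_spanSet {V : Type*} [AddCommMonoid V] {R : V → ℕ}
    (hR : ∀ a b, R (a + b) = R a ^^^ R b) (es : List V) (a : V) (j : ℕ) :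
    (spanSet (es.map R) (R a)).testBit j = true ↔ ∃ l : List V, l.Sublist es ∧ R (a + l.sum) = j := by
  induction es generalizing a with
  | nil => simp [spanSet, Nat.one_shiftLeft, Nat.testBit_two_pow]
  | cons e es ih =>
    rw [List.map_cons, spanSet, Nat.testBit_or, Bool.or_eq_true, ih, ← hR, ih]
    constructor
    · rintro (⟨l, hl, h⟩ | ⟨l, hl, h⟩)
      · exact ⟨l, hl.cons e, h⟩
      · exact ⟨e :: l, hl.cons_cons e, by rwa [List.sum_cons, ← add_assoc]⟩
    · rintro ⟨l, hl, h⟩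
      obtain hl | ⟨r, rfl, hr⟩ := List.sublist_cons_iff.1 hl
      · exact Or.inl ⟨l, hl, h⟩
      · exact Or.inr ⟨r, hr, by rwa [List.sum_cons, ← add_assoc] at h⟩

/-- A basis of the two-qubit operators. -/
def pauliBasis : List (OnSite 2) := [two .X .I, two .I .X, ZI, IZ]

/-- The rows `c ↦ symp (q c) E` for the elements `E` of a basis. -/
def anticommutationRows (q : Corner → OnSite 2) : List ℕ :=
  pauliBasis.map fun E => pack fun c => symp (q c) E

/-- The set of the bytes that record which corner operators anticommute with some `E`. -/
theorem testBit_spanSet_anticommutationRows {q : Corner → OnSite 2} {j : ℕ} :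
    (spanSet (anticommutationRows q) 0).testBit j = true ↔
      ∃ E, (pack fun c => symp (q c) E) = j := by
  have hR : ∀ E E', (pack fun c => symp (q c) (E + E')) =
      (pack fun c => symp (q c) E) ^^^ (pack fun c => symp (q c) E') := fun E E' => by
    rw [← pack_add]
    exact congrArg pack (funext fun c => symp_add_right _ _ _)
  have h0 : (pack fun c => symp (q c) 0) = 0 := by
    simp only [symp_zero_right]
    exact pack_zero
  have key := testBit_spanSet (R := fun E => pack fun c => symp (q c) E) hR pauliBasis 0 j
  simp only [h0, zero_add] at key
  rw [anticommutationRows, key]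
  have span : ∀ E : OnSite 2, ∃ l ∈ pauliBasis.sublists, l.sum = E := by decide +kernel
  constructor
  · rintro ⟨l, -, h⟩
    exact ⟨l.sum, h⟩
  · rintro ⟨E, h⟩
    obtain ⟨l, hl, rfl⟩ := span E
    exact ⟨l, List.mem_sublists.1 hl, h⟩

theorem IsSymplectic.spanSet_anticommutationRows {u : OnSite 2 ≃ₗ[ZMod 2] OnSite 2}
    (hu : IsSymplectic u) (q : Corner → OnSite 2) :
    spanSet (anticommutationRows fun c => u (q c)) 0 = spanSet (anticommutationRows q) 0 := by
  refine Nat.eq_of_testBit_eq fun j => ?_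
  rw [Bool.eq_iff_iff, testBit_spanSet_anticommutationRows, testBit_spanSet_anticommutationRows]
  constructor
  · rintro ⟨E, rfl⟩
    exact ⟨u.symm E, congrArg pack (funext fun c => by rw [← hu, u.apply_symm_apply])⟩
  · rintro ⟨E, rfl⟩
    exact ⟨u E, congrArg pack (funext fun c => hu _ _)⟩

theorem anticommutationRows_comp (q : Corner → OnSite 2) (σ : Corner ≃ Corner) :
    anticommutationRows (fun c => q (σ c)) = (anticommutationRows q).map (permuteByte σ) := by
  rw [anticommutationRows, anticommutationRows, List.map_map]
  exact List.map_congr_left fun E _ => pack_comp (fun c => symp (q c) E) σ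

/-- The coefficients of the products of two generators. -/
def coefficients : List (Fin 2 → ZMod 2) := [![0, 0], ![0, 1], ![1, 0], ![1, 1]]

theorem mem_coefficients (A : Fin 2 → ZMod 2) : A ∈ coefficients := by
  revert A
  decide

/-- The first generator of a listed code, moved by a symmetry of the cube, is not related to a
product of the generators of another listed code by a symplectic change of basis. -/
def tableCodesDiffer : Bool :=
  axisPerms.all fun π => allBelow 8 fun n => (List.finRange 18).all fun k =>
    (List.finRange 18).all fun l => k == l || coefficients.all fun A =>
      !(Nat.beq (spanSet ((anticommutationRows (tableGenerators k 0)).map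
        (permuteByte (cornerSym π (reflection n)).symm)) 0)
        (spanSet (anticommutationRows fun c => ∑ t, A t • tableGenerators l t c) 0))

theorem tableCodesDiffer_eq_true : tableCodesDiffer = true := by
  decide +kernel

theorem spanSet_tableGenerators_ne (π : Equiv.Perm (Fin 3)) {n : ℕ} (hn : n < 8) {k l : Fin 18}
    (hkl : k ≠ l) (A : Fin 2 → ZMod 2) :
    spanSet ((anticommutationRows (tableGenerators k 0)).map
      (permuteByte (cornerSym π (reflection n)).symm)) 0 ≠
      spanSet (anticommutationRows fun c => ∑ t, A t • tableGenerators l t c) 0 := by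
  have h := List.all_eq_true.1 tableCodesDiffer_eq_true π (mem_axisPerms π)
  have h := List.all_eq_true.1 (List.all_eq_true.1 (allBelow_eq_true.1 h n hn) k
    (List.mem_finRange k)) l (List.mem_finRange l)
  rw [Bool.or_eq_true, beq_iff_eq] at h
  have h := List.all_eq_true.1 (h.resolve_left hkl) A (mem_coefficients A)
  rw [Bool.not_eq_true'] at h
  exact Nat.ne_of_beq_eq_false h

/-- An equivalence maps the first generator of one code to a stabilizer element on a cube of the
other code, that is, to a product of its generators. The lists of bytes `c ↦ symp (q c) E` for
these cube operators are incompatible. -/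
theorem not_equivalent_tableCode {k l : Fin 18} (hkl : k ≠ l) :
    ¬ Equivalent (tableCode k) (tableCode l) := by
  rintro ⟨π, f, u, hu, h⟩
  obtain ⟨n, hn, rfl⟩ := exists_reflection_eq f
  have hmem : transform π (reflection n) u (place (tableGenerators k 0) 0) ∈ tableCode l := by
    rw [h]
    exact ⟨_, place_mem _ _ _, rfl⟩
  have hzero : cubeSymLinear π (reflection n) 0 = 0 := by
    funext i
    simp [cubeSymLinear]
  rw [transform_place, hzero] at hmem
  obtain ⟨A, hA⟩ := exists_eq_sum_of_mem_tableCode hmem (supportedOnCube_place _)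
  have hq : (fun c => u (tableGenerators k 0 ((cornerSym π (reflection n)).symm c))) =
      fun c => ∑ t, A t • tableGenerators l t c := funext fun c => by
    rw [← sum_smul_place_cornerSite, ← hA, place_zero_cornerSite]
  refine spanSet_tableGenerators_ne π hn hkl A ?_
  rw [← hq, hu.spanSet_anticommutationRows fun c =>
    tableGenerators k 0 ((cornerSym π (reflection n)).symm c), anticommutationRows_comp]

/-! ### Classification of the CSS codes -/

/-- The parity of the number of ones of a byte. -/
def oddByte (n : ℕ) : Bool :=
  n.testBit 0 ^^ n.testBit 1 ^^ n.testBit 2 ^^ n.testBit 3 ^^ n.testBit 4 ^^ n.testBit 5 ^^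
    n.testBit 6 ^^ n.testBit 7

/-- The set of bytes of even parity that satisfy `stringFreeByte`, as the binary digits of a
number. -/
def evenStringFreeBytes : ℕ :=
  0x240299649960660619612489468688069169628124868800660688068800000

theorem testBit_evenStringFreeBytes {w : Corner → ZMod 2} (h : StringFree w)
    (hsum : ∑ c, w c = 0) : evenStringFreeBytes.testBit (pack w) = true := by
  have all : allBelow 256 (fun n => evenStringFreeBytes.testBit n ==
      (stringFreeBytes.testBit n && !oddByte n)) = true := by
    decide +kernel
  have hodd : oddByte (pack w) = decide (∑ c, w c = 1) := by
    have hbit : ∀ i : Fin 8, (pack w).testBit i = decide (w (cornerIndex.symm i) = 1) := fun i => by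
      rw [← testBit_pack, cornerIndex.apply_symm_apply]
    rw [← cornerIndex.symm.sum_comp, Fin.sum_univ_eight]
    simp only [decide_add_eq_one, ← hbit]
    rfl
  have := allBelow_eq_true.1 all _ (pack_lt w)
  rw [beq_iff_eq, h.testBit, hodd, hsum] at this
  rw [this]
  decide

/-- The commutation of the corner `i` of a `Z`-type cube operator with the corner `j` of an
`X`-type one. The bytes `a`, `b` are the `Z` parts, and `p`, `q` are the `X` parts, on the two
qubits. -/
def overlapBit (a b p q i j : ℕ) : Bool :=
  (a.testBit i && p.testBit j) ^^ (b.testBit i && q.testBit j)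

/-- The operators commute if the cubes overlap in a corner or in an edge. The `X`-type
operator is inverted in space. -/
def overlapTest (a b p q : ℕ) : Bool :=
  Nat.beq (a &&& p) (b &&& q) && allBelow 8 fun i => [1, 2, 4].all fun e =>
    overlapBit a b p q i (i ^^^ e) == overlapBit a b p q (i ^^^ e) i

/-- The two corners are the ends of an edge. -/
def IsEdge (c c' : Corner) : Prop := ∃ i, ∀ j, c j = c' j ↔ j ≠ i

theorem IsEdge.symm_apply {c c' : Corner} (h : IsEdge c c') (π : Equiv.Perm (Fin 3))
    (f : Fin 3 → Bool) : IsEdge ((cornerSym π f).symm c) ((cornerSym π f).symm c') := by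
  obtain ⟨i, hi⟩ := h
  refine ⟨π i, fun j => ?_⟩
  rw [ne_eq, ← Equiv.symm_apply_eq, ← ne_eq, ← hi]
  by_cases hf : f (π.symm j) <;> simp [cornerSym, hf]

theorem exists_cornerIndex_of_isEdge {c c' : Corner} (h : IsEdge c c') :
    ∃ i e : Fin 8, e ∈ ({1, 2, 4} : Finset (Fin 8)) ∧ c = cornerIndex.symm i ∧
      c' = cornerIndex.symm (i ^^^ e) := by
  revert c c'
  unfold IsEdge
  decide +kernel

theorem exists_isEdge_of_xor : ∀ i < 8, ∀ e ∈ [1, 2, 4], ∃ c c' : Corner,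
    IsEdge c c' ∧ (cornerIndex c : ℕ) = i ∧ (cornerIndex c' : ℕ) = i ^^^ e := by
  unfold IsEdge
  decide +kernel

/-- Consequences of commutation for cubes that overlap in a corner or in an edge. -/
theorem Commuting.overlap {m : ℕ} {q q' : Corner → OnSite m} (h : Commuting q q') :
    (∀ c, symp (q c) (q' (antipode c)) = 0) ∧ ∀ c c', IsEdge c c' →
      symp (q c) (q' (antipode c')) = symp (q c') (q' (antipode c)) := by
  have rel : ∀ m s : Fin 8, s &&& m = s → ∑ i : Fin 8, (if i &&& m = m ^^^ s then
      symp (q (cornerIndex.symm i)) (q' (cornerIndex.symm (i ^^^ m))) else 0) = 0 :=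
    fun m s hms => by
      rw [← sum_overlap hms fun c c' => symp (q c) (q' c')]
      exact h _
  have hanti : ∀ i, antipode (cornerIndex.symm i) = cornerIndex.symm (i ^^^ 7) := by decide +kernel
  constructor
  · intro c
    obtain ⟨i, rfl⟩ := cornerIndex.symm.surjective c
    have hset : ∀ i j : Fin 8, j &&& 7 = 7 ^^^ (7 ^^^ i) ↔ j = i := by decide
    have := rel 7 (7 ^^^ i) (by revert i; decide)
    simp only [hset, Finset.sum_ite_eq', Finset.mem_univ, if_true] at this
    rw [hanti, this]
  · intro c c' hcc
    obtain ⟨i, e, he, rfl, rfl⟩ := exists_cornerIndex_of_isEdge hcc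
    have hset : ∀ e ∈ ({1, 2, 4} : Finset (Fin 8)), ∀ i : Fin 8,
        (Finset.univ.filter fun j => j &&& (7 ^^^ e) = (7 ^^^ e) ^^^ ((7 ^^^ e) ^^^ (i &&& (7 ^^^ e))))
          = {i, i ^^^ e} ∧ i ≠ i ^^^ e ∧ i ^^^ (7 ^^^ e) = i ^^^ e ^^^ 7 ∧
          i ^^^ e ^^^ (7 ^^^ e) = i ^^^ 7 ∧
          ((7 ^^^ e) ^^^ (i &&& (7 ^^^ e))) &&& (7 ^^^ e) = (7 ^^^ e) ^^^ (i &&& (7 ^^^ e)) := by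
      decide +kernel
    obtain ⟨h₁, h₂, h₃, h₄, h₅⟩ := hset e he i
    have := rel (7 ^^^ e) ((7 ^^^ e) ^^^ (i &&& (7 ^^^ e))) h₅
    rw [← Finset.sum_filter, h₁, Finset.sum_pair h₂, h₃, h₄] at this
    rw [hanti, hanti]
    exact CharTwo.add_eq_zero.1 this

theorem overlapTest_eq_true {a b p q : Corner → ZMod 2}
    (hdiag : ∀ c, a c * p c + b c * q c = 0)
    (hedge : ∀ c c', IsEdge c c' → a c * p c' + b c * q c' = a c' * p c + b c' * q c) :
    overlapTest (pack a) (pack b) (pack p) (pack q) = true := by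
  have hbit : ∀ c c', overlapBit (pack a) (pack b) (pack p) (pack q) (cornerIndex c)
      (cornerIndex c') = decide (a c * p c' + b c * q c' = 1) := fun c c' => by
    simp only [overlapBit, testBit_pack]
    generalize a c = x
    generalize b c = y
    generalize p c' = z
    generalize q c' = w
    revert x y z w
    decide
  rw [overlapTest, Bool.and_eq_true]
  constructor
  · have : pack a &&& pack p = pack b &&& pack q := by
      refine eq_of_testBit_cornerIndex (Nat.and_lt_two_pow (n := 8) _ (pack_lt _))
        (Nat.and_lt_two_pow (n := 8) _ (pack_lt _)) fun c => ?_
      simp only [Nat.testBit_and, testBit_pack]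
      have := hdiag c
      generalize a c = x, b c = y, p c = z, q c = w at this
      revert x y z w
      decide
    rw [this]
    exact Nat.beq_refl _
  · refine allBelow_eq_true.2 fun i hi => List.all_eq_true.2 fun e he => ?_
    obtain ⟨c, c', hcc, h, h'⟩ := exists_isEdge_of_xor i hi e he
    rw [← h', ← h, hbit, hbit, hedge c c' hcc, beq_self_eq_true]

/-- With a single qubit per site, corner and edge overlaps already exclude CSS codes. -/
def noOverlapPair : Bool :=
  allBelow 256 fun a => !(evenStringFreeBytes.testBit a) || allBelow 256 fun p =>
    !(evenStringFreeBytes.testBit p) || !(overlapTest a 0 p 0)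

theorem noOverlapPair_eq_true : noOverlapPair = true := by
  decide +kernel

/-- The `Z` part on the qubit `i` of the first generator of a listed code. -/
def tableZ (k : Fin 18) (i : Fin 2) (c : Corner) : ZMod 2 := (firstGenerator k c).2 i

/-- The byte of `tableZ k i`. -/
def tableByte (k : Fin 18) (i : Fin 2) : ℕ := pack (tableZ k i)

/-- The codes `1, …, 17`. -/
def cssCodes : List (Fin 18) := (List.finRange 18).tail

/-- For the listed CSS codes, the second generator is determined by the first one. -/
def dualUnique : Bool :=
  cssCodes.all fun k => allBelow 256 fun p => !(evenStringFreeBytes.testBit p) ||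
    allBelow 256 fun q => !(evenStringFreeBytes.testBit q) ||
      !(overlapTest (tableByte k 0) (tableByte k 1) p q) ||
        (Nat.beq p (tableByte k 1) && Nat.beq q (tableByte k 0))

theorem dualUnique_eq_true : dualUnique = true := by
  decide +kernel

/-- The union of the values, as sets of binary digits. -/
def bitUnion {α : Type*} (l : List α) (f : α → ℕ) : ℕ := l.foldr (fun x s => f x ||| s) 0

theorem testBit_bitUnion {α : Type*} {l : List α} {f : α → ℕ} {j : ℕ} :
    (bitUnion l f).testBit j = true ↔ ∃ x ∈ l, (f x).testBit j = true := by
  induction l with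
  | nil => simp [bitUnion]
  | cons x l ih =>
    change (f x ||| bitUnion l f).testBit j = true ↔ _
    simp [ih]

/-- The invertible `2 × 2` matrices over the field with two elements, row by row. -/
def baseChanges : List (Bool × Bool × Bool × Bool) :=
  [(true, false, false, true), (false, true, true, false), (true, false, true, true),
    (true, true, true, false), (false, true, true, true), (true, true, false, true)]

/-- The linear combination of two bytes with coefficients `x` and `y`. -/
def combineBytes (x y : Bool) (a b : ℕ) : ℕ := cond x a 0 ^^^ cond y b 0

/-- The pairs of bytes of the listed CSS codes up to symmetries of the cube and changes of basis,
where the pair `(a, b)` is the binary digit number `256 * a + b`. -/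
def tableOrbits : ℕ :=
  bitUnion cssCodes fun k => bitUnion axisPerms fun π => bitUnion (List.range 8) fun n =>
    bitUnion baseChanges fun w =>
      let a := permuteByte (cornerSym π (reflection n)) (tableByte k 0)
      let b := permuteByte (cornerSym π (reflection n)) (tableByte k 1)
      1 <<< (256 * combineBytes w.1 w.2.1 a b + combineBytes w.2.2.1 w.2.2.2 a b)

/-- All pairs of bytes that span a plane of string-free even bytes are listed. -/
def pairsInTableOrbits : Bool :=
  allBelow 256 fun a => !(evenStringFreeBytes.testBit a) || allBelow 256 fun b =>
    !(evenStringFreeBytes.testBit b) || !(evenStringFreeBytes.testBit (a ^^^ b)) ||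
      tableOrbits.testBit (256 * a + b)

theorem pairsInTableOrbits_eq_true : pairsInTableOrbits = true := by
  decide +kernel

/-- The corresponding element of the field with two elements. -/
def scalar (x : Bool) : ZMod 2 := cond x 1 0

theorem combineBytes_pack (x y : Bool) (a b : Corner → ZMod 2) :
    combineBytes x y (pack a) (pack b) = pack fun c => scalar x * a c + scalar y * b c := by
  have h : ∀ (x : Bool) (a : Corner → ZMod 2), cond x (pack a) 0 = pack fun c => scalar x * a c := by
    intro x a
    cases x
    · simp only [scalar, cond_false, zero_mul]
      exact pack_zero.symm
    · simp only [scalar, cond_true, one_mul]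
  rw [combineBytes, h, h, ← pack_add]
  rfl

theorem mem_cssCodes {k : Fin 18} : k ∈ cssCodes ↔ k ≠ 0 := by
  revert k
  decide

theorem exists_tableZ_of_plane {a b : Corner → ZMod 2} (ha : StringFree a) (hb : StringFree b)
    (hab : StringFree (a + b)) (ha0 : ∑ c, a c = 0) (hb0 : ∑ c, b c = 0) :
    ∃ k : Fin 18, k ≠ 0 ∧ ∃ π f, ∃ w ∈ baseChanges,
      (∀ c, a c = scalar w.1 * tableZ k 0 (cornerSym π f c) +
        scalar w.2.1 * tableZ k 1 (cornerSym π f c)) ∧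
      ∀ c, b c = scalar w.2.2.1 * tableZ k 0 (cornerSym π f c) +
        scalar w.2.2.2 * tableZ k 1 (cornerSym π f c) := by
  have h := allBelow_eq_true.1 pairsInTableOrbits_eq_true _ (pack_lt a)
  rw [testBit_evenStringFreeBytes ha ha0, Bool.not_true, Bool.false_or] at h
  have h := allBelow_eq_true.1 h _ (pack_lt b)
  rw [testBit_evenStringFreeBytes hb hb0, ← pack_add, testBit_evenStringFreeBytes hab (by
    simp only [Pi.add_apply, Finset.sum_add_distrib, ha0, hb0, add_zero]), Bool.not_true,
    Bool.false_or, Bool.false_or] at h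
  simp only [tableOrbits, testBit_bitUnion, Nat.one_shiftLeft, Nat.testBit_two_pow,
    decide_eq_true_eq, tableByte, ← pack_comp, combineBytes_pack] at h
  obtain ⟨k, hk, π, -, n, -, w, hw, h⟩ := h
  have split : ∀ {u v u' v' : Corner → ZMod 2}, 256 * pack u + pack v = 256 * pack u' + pack v' →
      u' = u ∧ v' = v := fun {u v u' v'} h => by
    have h₁ := pack_lt v
    have h₂ := pack_lt v'
    exact ⟨pack_injective (by omega), pack_injective (by omega)⟩
  obtain ⟨h₁, h₂⟩ := split h
  exact ⟨k, mem_cssCodes.1 hk, π, reflection n, w, hw, congrFun h₁, congrFun h₂⟩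

/-- The commutation relations between the two generators of a CSS code are those of a listed code
up to a symmetry of the cube. Here `a`, `b` are the `Z` parts of the first generator, and `p`, `q`
are the `X` parts of the spatial inversion of the second one, on the two qubits. The first
generator is in a listed orbit, and for the listed codes it determines the second generator. -/
theorem exists_gram_eq_tableZ {a b p q : Corner → ZMod 2}
    (hab : ∀ x y : Bool, (x || y) = true → StringFree fun c => scalar x * a c + scalar y * b c)
    (hpq : ∀ x y : Bool, (x || y) = true → StringFree fun c => scalar x * p c + scalar y * q c)
    (ha : ∑ c, a c = 0) (hb : ∑ c, b c = 0) (hp : ∑ c, p c = 0) (hq : ∑ c, q c = 0)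
    (hdiag : ∀ c, a c * p c + b c * q c = 0)
    (hedge : ∀ c c', IsEdge c c' → a c * p c' + b c * q c' = a c' * p c + b c' * q c) :
    ∃ k : Fin 18, k ≠ 0 ∧ ∃ π f, ∀ c c', a c * p c' + b c * q c' =
      tableZ k 0 (cornerSym π f c) * tableZ k 1 (cornerSym π f c') +
        tableZ k 1 (cornerSym π f c) * tableZ k 0 (cornerSym π f c') := by
  obtain ⟨k, hk, π, f, ⟨x, y, z, t⟩, hw, ha', hb'⟩ := exists_tableZ_of_plane
    (a := a) (b := b) (by simpa [scalar] using hab true false rfl)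
    (by simpa [scalar] using hab false true rfl)
    (by simpa [scalar, Pi.add_def] using hab true true rfl) ha hb
  simp only at ha' hb'
  refine ⟨k, hk, π, f, ?_⟩
  -- The second generator changes with the inverse transpose of the change of basis.
  set σ := cornerSym π f with hσ
  set p' : Corner → ZMod 2 := fun c => scalar x * p (σ.symm c) + scalar z * q (σ.symm c) with hp'
  set q' : Corner → ZMod 2 := fun c => scalar y * p (σ.symm c) + scalar t * q (σ.symm c) with hq'
  have hcols : (x || z) = true ∧ (y || t) = true :=
    (by decide : ∀ w ∈ baseChanges, (w.1 || w.2.2.1) = true ∧ (w.2.1 || w.2.2.2) = true) _ hw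
  have hfree : ∀ x z : Bool, (x || z) = true →
      StringFree fun c => scalar x * p (σ.symm c) + scalar z * q (σ.symm c) := fun x z hxz => by
    rw [← stringFree_comp_cornerSym (π := π) (f := f)]
    simpa only [← hσ, Equiv.symm_apply_apply] using hpq x z hxz
  have hsum : ∀ x z : ZMod 2, ∑ c, (x * p (σ.symm c) + z * q (σ.symm c)) = 0 := fun x z => by
    rw [Finset.sum_add_distrib, ← Finset.mul_sum, ← Finset.mul_sum, σ.symm.sum_comp,
      σ.symm.sum_comp, hp, hq, mul_zero, mul_zero, add_zero]
  have gram : ∀ c c', tableZ k 0 (σ c) * p' (σ c') + tableZ k 1 (σ c) * q' (σ c') =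
      a c * p c' + b c * q c' := fun c c' => by
    simp only [hp', hq', Equiv.symm_apply_apply, ha' c, hb' c]
    ring
  have gram' : ∀ c c', tableZ k 0 c * p' c' + tableZ k 1 c * q' c' =
      a (σ.symm c) * p (σ.symm c') + b (σ.symm c) * q (σ.symm c') := fun c c' => by
    rw [← gram, σ.apply_symm_apply, σ.apply_symm_apply]
  have htest : overlapTest (tableByte k 0) (tableByte k 1) (pack p') (pack q') = true :=
    overlapTest_eq_true (fun c => by rw [gram', hdiag]) fun c c' h => by
      rw [gram', gram', hedge _ _ (h.symm_apply π f)]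
  have huniq := allBelow_eq_true.1 (List.all_eq_true.1 dualUnique_eq_true k (mem_cssCodes.2 hk)) _
    (pack_lt p')
  rw [testBit_evenStringFreeBytes (hfree x z hcols.1) (hsum _ _), Bool.not_true,
    Bool.false_or] at huniq
  have huniq := allBelow_eq_true.1 huniq _ (pack_lt q')
  rw [testBit_evenStringFreeBytes (hfree y t hcols.2) (hsum _ _), htest, Bool.not_true,
    Bool.false_or, Bool.false_or, Bool.and_eq_true] at huniq
  have hp1 : p' = tableZ k 1 := pack_injective (Nat.eq_of_beq_eq_true huniq.1)
  have hq0 : q' = tableZ k 0 := pack_injective (Nat.eq_of_beq_eq_true huniq.2)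
  intro c c'
  rw [← gram, hp1, hq0]

/-- If the first generators are of `Z` type and the second ones of `X` type, then only the
commutation relations between the two matter. -/
theorem gram_of_css {m n : ℕ} {g : Fin 2 → Corner → OnSite m} {h : Fin 2 → Corner → OnSite n}
    (hg₀ : ∀ c, (g 0 c).1 = 0) (hg₁ : ∀ c, (g 1 c).2 = 0) (hh₀ : ∀ c, (h 0 c).1 = 0)
    (hh₁ : ∀ c, (h 1 c).2 = 0) (π : Equiv.Perm (Fin 3)) (f : Fin 3 → Bool)
    (gram : ∀ c c', symp (g 0 c) (g 1 (antipode c')) =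
      symp (h 0 (cornerSym π f c)) (h 1 (antipode (cornerSym π f c')))) (t t' : Fin 2)
    (c c' : Corner) :
    symp (g t c) (g t' c') = symp (h t (cornerSym π f c)) (h t' (cornerSym π f c')) := by
  have gram' : ∀ c c', symp (g 0 c) (g 1 c') =
      symp (h 0 (cornerSym π f c)) (h 1 (cornerSym π f c')) := fun c c' => by
    rw [← antipode_antipode c', gram, ← cornerSym_antipode]
  obtain rfl | rfl : t = 0 ∨ t = 1 := by omega
  · obtain rfl | rfl : t' = 0 ∨ t' = 1 := by omega
    · simp [symp, hg₀, hh₀]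
    · exact gram' c c'
  · obtain rfl | rfl : t' = 0 ∨ t' = 1 := by omega
    · rw [symp_comm, gram', symp_comm]
    · simp [symp, hg₁, hh₁]

/-- In an admissible CSS code, no string operator of `X` type commutes with the first generator,
and none of `Z` type commutes with the second one. -/
theorem IsAdmissible.stringFree_of_css {m : ℕ} {g : Fin 2 → Corner → OnSite m}
    (h : IsAdmissible (stabilizerGroup g)) (hg₀ : ∀ c, (g 0 c).1 = 0) (hg₁ : ∀ c, (g 1 c).2 = 0)
    {x : Fin m → ZMod 2} (hx : x ≠ 0) :
    (StringFree fun c => ∑ i, x i * (g 0 c).2 i) ∧ StringFree fun c => ∑ i, x i * (g 1 c).1 i := by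
  have h₀ : ∀ c, symp (g 0 c) (x, 0) = ∑ i, x i * (g 0 c).2 i := fun c => by
    simp [symp, mul_comm]
  have h₁ : ∀ c, symp (g 1 c) (0, x) = ∑ i, x i * (g 1 c).1 i := fun c => by
    simp [symp, mul_comm]
  have h₂ : ∀ c, symp (g 0 c) (0, x) = 0 := fun c => by simp [symp, hg₀]
  have h₃ : ∀ c, symp (g 1 c) (x, 0) = 0 := fun c => by simp [symp, hg₁]
  constructor
  · intro v hv
    obtain ⟨t, c₀, hc⟩ := h.exists_lineSum_ne_zero (E := (x, 0))
      (fun h => hx (congrArg Prod.fst h)) hv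
    obtain rfl | rfl : t = 0 ∨ t = 1 := by omega
    · exact ⟨c₀, by simpa only [h₀] using hc⟩
    · simp [h₃, lineSum] at hc
  · intro v hv
    obtain ⟨t, c₀, hc⟩ := h.exists_lineSum_ne_zero (E := (0, x))
      (fun h => hx (congrArg Prod.snd h)) hv
    obtain rfl | rfl : t = 0 ∨ t = 1 := by omega
    · simp [h₂, lineSum] at hc
    · exact ⟨c₀, by simpa only [h₁] using hc⟩

theorem stringFree_comp_antipode {w : Corner → ZMod 2} (h : StringFree w) :
    StringFree fun c => w (antipode c) :=
  stringFree_comp_cornerSym (π := 1) (f := fun _ => true) |>.2 h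

theorem sum_comp_antipode (w : Corner → ZMod 2) : ∑ c, w (antipode c) = ∑ c, w c :=
  (cornerSym 1 fun _ => true).sum_comp w

theorem not_isCSSCubicCode_one (S : AddSubgroup (FinitePauli 1)) : ¬ IsCSSCubicCode S := by
  rintro ⟨h, g, rfl, hg₀, hg₁, hsum⟩
  obtain ⟨hfree₀, hfree₁⟩ := h.stringFree_of_css hg₀ hg₁ (x := fun _ => 1)
    fun h => one_ne_zero (congrFun h 0)
  simp only [Finset.univ_unique, Fin.default_eq_zero, one_mul, Finset.sum_singleton] at hfree₀ hfree₁
  obtain ⟨hdiag, hedge⟩ := (stabilizerGroup_commutes_iff.1 h.commutes 0 1).overlap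
  have hsymp : ∀ c c', symp (g 0 c) (g 1 (antipode c')) =
      (g 0 c).2 0 * (g 1 (antipode c')).1 0 := fun c c' => by simp [symp, hg₀]
  simp only [hsymp] at hdiag hedge
  have htest := overlapTest_eq_true (a := fun c => (g 0 c).2 0) (b := 0)
    (p := fun c => (g 1 (antipode c)).1 0) (q := 0) (by simpa using hdiag) (by simpa using hedge)
  rw [pack_zero] at htest
  have hno := allBelow_eq_true.1 noOverlapPair_eq_true _ (pack_lt fun c => (g 0 c).2 0)
  have hsum₀ : ∑ c, (g 0 c).2 0 = 0 := by
    simpa [Prod.snd_sum] using congrFun (congrArg Prod.snd (hsum 0)) 0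
  have hsum₁ : ∑ c, (g 1 c).1 0 = 0 := by
    simpa [Prod.fst_sum] using congrFun (congrArg Prod.fst (hsum 1)) 0
  rw [testBit_evenStringFreeBytes hfree₀ hsum₀, Bool.not_true, Bool.false_or] at hno
  have hno := allBelow_eq_true.1 hno _ (pack_lt fun c => (g 1 (antipode c)).1 0)
  rw [htest, testBit_evenStringFreeBytes
    (stringFree_comp_antipode (w := fun c => (g 1 c).1 0) hfree₁)
    ((sum_comp_antipode fun c => (g 1 c).1 0).trans hsum₁)] at hno
  exact Bool.false_ne_true hno

theorem exists_equivalent_tableCode {S : AddSubgroup (FinitePauli 2)} (hS : IsCSSCubicCode S) :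
    ∃ k : Fin 18, k ≠ 0 ∧ Equivalent S (tableCode k) := by
  obtain ⟨h, g, rfl, hg₀, hg₁, hsum⟩ := hS
  obtain ⟨hdiag, hedge⟩ := (stabilizerGroup_commutes_iff.1 h.commutes 0 1).overlap
  have hsymp : ∀ c c', symp (g 0 c) (g 1 (antipode c')) =
      (g 0 c).2 0 * (g 1 (antipode c')).1 0 + (g 0 c).2 1 * (g 1 (antipode c')).1 1 :=
    fun c c' => by simp [symp, hg₀, Fin.sum_univ_two]
  have hsum₀ : ∀ i, ∑ c, (g 0 c).2 i = 0 := fun i => by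
    simpa [Prod.snd_sum] using congrFun (congrArg Prod.snd (hsum 0)) i
  have hsum₁ : ∀ i, ∑ c, (g 1 c).1 i = 0 := fun i => by
    simpa [Prod.fst_sum] using congrFun (congrArg Prod.fst (hsum 1)) i
  have hne : ∀ x y : Bool, (x || y) = true → ![scalar x, scalar y] ≠ 0 := by decide
  have hfree := fun x y hxy => h.stringFree_of_css hg₀ hg₁ (hne x y hxy)
  simp only [Fin.sum_univ_two, Matrix.cons_val_zero, Matrix.cons_val_one] at hfree
  simp only [hsymp] at hdiag hedge
  obtain ⟨k, hk, π, f, gram⟩ := exists_gram_eq_tableZ (a := fun c => (g 0 c).2 0)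
    (b := fun c => (g 0 c).2 1) (p := fun c => (g 1 (antipode c)).1 0)
    (q := fun c => (g 1 (antipode c)).1 1) (fun x y hxy => (hfree x y hxy).1)
    (fun x y hxy => stringFree_comp_antipode (hfree x y hxy).2) (hsum₀ 0) (hsum₀ 1)
    ((sum_comp_antipode fun c => (g 1 c).1 0).trans (hsum₁ 0))
    ((sum_comp_antipode fun c => (g 1 c).1 1).trans (hsum₁ 1)) hdiag hedge
  refine ⟨k, hk, equivalent_of_gram π f h.isSeparating (isSeparating_tableGenerators k)
    (gram_of_css hg₀ hg₁ (tableGenerators_zero_fst hk) (tableGenerators_one_snd hk) π f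
      fun c c' => ?_)⟩
  rw [hsymp, gram]
  simp [symp, tableGenerators, hk, antipode_antipode, dualX, tableZ, Fin.sum_univ_two]

end CubicCode

theorem mainTheorem3 :
    (∀ S : AddSubgroup (CubicCode.FinitePauli 1),
      ¬ CubicCode.IsInversionCubicCode S ∧ ¬ CubicCode.IsCSSCubicCode S) ∧
    (CubicCode.IsInversionCubicCode (CubicCode.tableCode 0) ∧
      ¬ CubicCode.IsCSS (CubicCode.tableCode 0)) ∧
    (∀ k : Fin 18, k ≠ 0 → CubicCode.IsCSSCubicCode (CubicCode.tableCode k)) ∧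
    (∀ S : AddSubgroup (CubicCode.FinitePauli 2), CubicCode.IsInversionCubicCode S →
      ¬ CubicCode.IsCSS S ∧ CubicCode.Equivalent S (CubicCode.tableCode 0)) ∧
    (∀ S : AddSubgroup (CubicCode.FinitePauli 2), CubicCode.IsCSSCubicCode S →
      ∃ k : Fin 18, k ≠ 0 ∧ CubicCode.Equivalent S (CubicCode.tableCode k)) ∧
    (∀ k l : Fin 18, k ≠ l →
      ¬ CubicCode.Equivalent (CubicCode.tableCode k) (CubicCode.tableCode l)) := by
  refine ⟨fun S => ⟨CubicCode.not_isInversionCubicCode_one S, CubicCode.not_isCSSCubicCode_one S⟩,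
    ⟨CubicCode.isInversionCubicCode_tableCode_zero, CubicCode.not_isCSS_tableCode_zero⟩,
    fun k hk => CubicCode.isCSSCubicCode_tableCode hk, fun S hS => ?_,
    fun S hS => CubicCode.exists_equivalent_tableCode hS,
    fun k l hkl => CubicCode.not_equivalent_tableCode hkl⟩
  have h := CubicCode.equivalent_tableCode_zero hS
  exact ⟨fun hcss => CubicCode.not_isCSS_tableCode_zero (hcss.of_equivalent h), h⟩
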